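/- Let $S_n$ be the symmetric group on $\{1,\dots,n\}$, with product $(uv)(j)=u(v(j))$, generating set $S=\{s_1,\dots,s_{n-1}\}$ of adjacent transpositions ($s_k$ exchanges $k$ and $k+1$), length function $\ell$ with respect to $S$, and Bruhat order $\le$ ($u\le v$ if $v=ut_1\cdots t_r$ with $r\ge 0$ and reflections $t_1,\dots,t_r$ such that the length increases strictly at each step). For $J\subseteq S$ let $(S_n)^J=\{w\in S_n : \ell(sw)>\ell(w)\ \text{for all } s\in J\}$, and for $w\in S_n$ let $D_R(w)=\{s\in S:\ell(ws)<\ell(w)\}$. For $x\in\{q,-1\}$ the parabolic $R$-polynomials $R^{J,x}_{u,v}(q)\in\mathbb Z[q]$, $u,v\in (S_n)^J$, are determined by: $R^{J,x}_{u,v}=0$ if $u\not\le v$; $R^{J,x}_{u,u}=1$; and, if $u<v$ and $s\in D_R(v)$, $$R^{J,x}_{u,v}=\begin{cases}R^{J,x}_{us,vs}, & s\in D_R(u),\\ qR^{J,x}_{us,vs}+(q-1)R^{J,x}_{u,vs}, & s\notin D_R(u),\ us\in (S_n)^J,\\ (q-1-x)R^{J,x}_{u,vs}, & s\notin D_R(u),\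 us\notin (S_n)^J.\end{cases}$$ Let $3\le i\le n-1$ and $J=S\setminus\{s_{i-2},s_{i-1},s_i\}$. For $u,v\in (S_n)^J$ put $$A(u,v)=\{t\in\{i-1,i\} : u^{-1}(t)\ge v^{-1}(t)\},\qquad B(u,v)=\{1,\dots,i-2\}\cup A(u,v),$$ $$a_j(u,v)=|\{r\in u^{-1}(B(u,v)) : r<j\}|-|\{r\in v^{-1}(B(u,v)) : r<j\}|\quad(1\le j\le n),$$ $$D(u,v)=v^{-1}(B(u,v))\setminus u^{-1}(B(u,v)).$$ **Theorem.** Let $v\in (S_n)^J$ be such that $i$ appears after $i-1$ in $v$, that is, $v^{-1}(i-1)<v^{-1}(i)$. Then for every $u\in (S_n)^J$ with $u\le v$, $$R^{J,q}_{u,v}(q)=(-1)^{\ell(v)-\ell(u)}\,F_{u,v}(q),\qquad R^{J,-1}_{u,v}(q)=q^{\ell(v)-\ell(u)}\,F_{u,v}(1/q),$$ where $$F_{u,v}(q)=\prod_{t\in\{i-1,i\}}\Bigl(1-q+\delta_{u^{-1}(t),v^{-1}(t)}\,q^{1+a_{v^{-1}(t)}(u,v)}\Bigr)\prod_{j\in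 D(u,v)}\Bigl(1-q^{a_j(u,v)}\Bigr)$$ and $\delta$ is the Kronecker delta. -/

import Mathlib

open scoped Polynomial LaurentPolynomial

namespace ParabolicKL

section General

variable {W : Type*} [Group W]

/-- The length of `w` with respect to the generating set `S`: the smallest `k` such that `w` is a
product of `k` elements of `S`. -/
noncomputable def length (S : Set W) (w : W) : ℕ :=
  sInf {k | ∃ l : List W, (∀ s ∈ l, s ∈ S) ∧ l.prod = w ∧ l.length = k}

/-- The set of reflections `T = {w s w⁻¹ | w ∈ W, s ∈ S}`. -/
def reflections (S : Set W) : Set W :=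
  {t | ∃ w : W, ∃ s ∈ S, t = w * s * w⁻¹}

/-- The Bruhat order: `u ≤ v` if `v = u t₁ ⋯ t_r` with reflections `t₁, …, t_r` (`r ≥ 0`) such
that the length increases strictly at each step. -/
def BruhatLE (S : Set W) (u v : W) : Prop :=
  Relation.ReflTransGen
    (fun a b : W => ∃ t ∈ reflections S, b = a * t ∧ length S a < length S b) u v

/-- `W^J = {w | ℓ(s w) > ℓ(w) for all s ∈ J}`. -/
def minReps (S J : Set W) : Set W :=
  {w | ∀ s ∈ J, length S w < length S (s * w)}

/-- The set `D_R(w)` of right descents. -/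
def rightDescents (S : Set W) (w : W) : Set W :=
  {s | s ∈ S ∧ length S (w * s) < length S w}

open Classical in
/-- The right-hand side of Deodhar's recursion for `R_{u,v}^{J,x}` along the generator `s`,
where `R` is a (candidate) family of polynomials. -/
noncomputable def recursionStep (S J : Set W) (x : ℤ[X]) (R : W → W → ℤ[X]) (s u v : W) : ℤ[X] :=
  if s ∈ rightDescents S u then R (u * s) (v * s)
  else if u * s ∈ minReps S J then
    Polynomial.X * R (u * s) (v * s) + (Polynomial.X - 1) * R u (v * s)
  else (Polynomial.X - 1 - x) * R u (v * s)

/-- The property which characterizes the family of parabolic `R`-polynomials of type `x`, where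
`x` is `q` (that is, `Polynomial.X`) or `-1`. Only the values at `u, v ∈ W^J` matter. -/
structure IsParabolicRFamily (S J : Set W) (x : ℤ[X]) (R : W → W → ℤ[X]) : Prop where
  eq_zero : ∀ u ∈ minReps S J, ∀ v ∈ minReps S J, ¬ BruhatLE S u v → R u v = 0
  eq_one : ∀ u ∈ minReps S J, R u u = 1
  eq_step : ∀ u ∈ minReps S J, ∀ v ∈ minReps S J, BruhatLE S u v → u ≠ v →
    ∀ s ∈ rightDescents S v, R u v = recursionStep S J x R s u v

open Classical in
/-- The parabolic `R`-polynomial `R_{u,v}^{J,x}(q)`, for `x` equal to `q = Polynomial.X` or `-1`,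
computed by Deodhar's recursion: it is `0` if `u ≰ v`, it is `1` if `u = v`, and for `u < v` one
applies the recursion along a right descent of `v`. (The three branches under `h` are
`recursionStep`, see `parabolicR_eq`; the result does not depend on the descents used. The last
`0` is never reached in a Coxeter group, where `u < v` forces `v` to have a right descent.) -/
noncomputable def parabolicR (S J : Set W) (x : ℤ[X]) (u v : W) : ℤ[X] :=
  if ¬ BruhatLE S u v then 0
  else if u = v then 1
  else if h : ∃ s, s ∈ rightDescents S v then
    if h.choose ∈ rightDescents S u then
      parabolicR S J x (u * h.choose) (v * h.choose)
    else if u * h.choose ∈ minReps S J then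
      Polynomial.X * parabolicR S J x (u * h.choose) (v * h.choose)
        + (Polynomial.X - 1) * parabolicR S J x u (v * h.choose)
    else (Polynomial.X - 1 - x) * parabolicR S J x u (v * h.choose)
  else 0
termination_by length S v
decreasing_by all_goals exact h.choose_spec.2

end General

section SymmetricGroup

/-- The adjacent transposition `s_k`, `1 ≤ k ≤ n - 1`, of the letters `k` and `k + 1`. The group
`S_n` is `Equiv.Perm (Fin n)`, with product `(u v)(j) = u (v j)`; the letter (or position)
`t ∈ {1, …, n}` is the element of `Fin n` with underlying number `t - 1`. -/
def adj (n k : ℕ) (h1 : 1 ≤ k) (h2 : k < n) : Equiv.Perm (Fin n) :=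
  Equiv.swap ⟨k - 1, by omega⟩ ⟨k, h2⟩

/-- The generating set `S = {s_1, …, s_{n-1}}` of `S_n`. -/
def gens (n : ℕ) : Set (Equiv.Perm (Fin n)) :=
  {s | ∃ (k : ℕ) (h1 : 1 ≤ k) (h2 : k < n), s = adj n k h1 h2}

/-- The letter `t ∈ {1, …, n}` as an element of `Fin n`. -/
def letter (n t : ℕ) (h1 : 1 ≤ t) (h2 : t ≤ n) : Fin n := ⟨t - 1, by omega⟩

/-- The set of inversions of `w`. -/
def inversions {n : ℕ} (w : Equiv.Perm (Fin n)) : Finset (Fin n × Fin n) :=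
  Finset.univ.filter fun p => p.1 < p.2 ∧ w p.2 < w p.1

end SymmetricGroup

section Facts

variable {W : Type*} [Group W]

theorem parabolicR_eq (S J : Set W) (x : ℤ[X]) (u v : W) (huv : BruhatLE S u v) (hne : u ≠ v)
    (h : ∃ s, s ∈ rightDescents S v) :
    ∃ s ∈ rightDescents S v,
      parabolicR S J x u v = recursionStep S J x (parabolicR S J x) s u v := by
  refine ⟨h.choose, h.choose_spec, ?_⟩
  rw [parabolicR]
  simp [huv, hne, h, recursionStep]

theorem length_le_of_word (S : Set W) (l : List W) (hl : ∀ s ∈ l, s ∈ S) :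
    length S l.prod ≤ l.length :=
  Nat.sInf_le ⟨l, hl, rfl, rfl⟩

theorem length_lt_of_bruhat_ne {S : Set W} {u v : W} (h : BruhatLE S u v) (hne : u ≠ v) :
    length S u < length S v := by
  have key : u = v ∨ length S u < length S v := by
    clear hne
    induction h with
    | refl => exact Or.inl rfl
    | tail _ hs ih =>
      obtain ⟨t, _, _, hlt⟩ := hs
      rcases ih with rfl | ih
      · exact Or.inr hlt
      · exact Or.inr (ih.trans hlt)
  exact key.resolve_left hne

/-- If the generators are involutions, an element of positive length has a right descent. -/
theorem exists_rightDescent {S : Set W} (hS : ∀ s ∈ S, s * s = 1) {v : W}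
    (hv : 0 < length S v) : ∃ s, s ∈ rightDescents S v := by
  have hne : {k | ∃ l : List W, (∀ s ∈ l, s ∈ S) ∧ l.prod = v ∧ l.length = k}.Nonempty :=
    Nat.nonempty_of_pos_sInf hv
  obtain ⟨l, hl, hp, hk⟩ := Nat.sInf_mem hne
  have hk' : l.length = length S v := hk
  rcases List.eq_nil_or_concat l with rfl | ⟨l', s, rfl⟩
  · simp at hk'
    omega
  · simp only [List.concat_eq_append, List.mem_append, List.mem_singleton, List.prod_append,
      List.prod_singleton, List.length_append, List.length_singleton] at hl hp hk'
    refine ⟨s, hl s (Or.inr rfl), ?_⟩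
    have h1 : v * s = l'.prod := by
      rw [← hp, mul_assoc, hS s (hl s (Or.inr rfl)), mul_one]
    have h2 := length_le_of_word S l' (fun a ha => hl a (Or.inl ha))
    rw [h1]
    omega

theorem adj_mul_self {n k : ℕ} (h1 : 1 ≤ k) (h2 : k < n) : adj n k h1 h2 * adj n k h1 h2 = 1 := by
  simp [adj]

theorem adj_lt {n k : ℕ} (h1 : 1 ≤ k) (h2 : k < n) {p q : Fin n} (hpq : p < q)
    (hne : ¬ ((p : ℕ) = k - 1 ∧ (q : ℕ) = k)) : adj n k h1 h2 p < adj n k h1 h2 q := by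
  simp only [adj, Equiv.swap_apply_def]
  simp only [Fin.ext_iff]
  have hpq' := Fin.lt_def.mp hpq
  split_ifs <;> rw [Fin.lt_def] <;> (try simp only) <;> omega

theorem mem_inversions {n : ℕ} (w : Equiv.Perm (Fin n)) (p q : Fin n) :
    (p, q) ∈ inversions w ↔ p < q ∧ w q < w p := by
  simp [inversions]

theorem card_inv_mul_adj {n k : ℕ} (h1 : 1 ≤ k) (h2 : k < n) (w : Equiv.Perm (Fin n))
    (h : w ⟨k - 1, by omega⟩ < w ⟨k, h2⟩) :
    (inversions (w * adj n k h1 h2)).card = (inversions w).card + 1 := by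
  set s := adj n k h1 h2 with hs
  have sa : s ⟨k - 1, by omega⟩ = ⟨k, h2⟩ := by simp [hs, adj]
  have sb : s ⟨k, h2⟩ = ⟨k - 1, by omega⟩ := by simp [hs, adj]
  have ss : ∀ p, s (s p) = p := fun p => by
    have := congrArg (fun f : Equiv.Perm (Fin n) => f p) (adj_mul_self h1 h2)
    simpa using this
  have key : inversions (w * s) = insert ((⟨k - 1, by omega⟩ : Fin n), (⟨k, h2⟩ : Fin n))
      ((inversions w).map (Equiv.prodCongr s s).toEmbedding) := by
    ext ⟨p, q⟩
    have e : (Equiv.prodCongr s s).symm (p, q) = (s p, s q) := by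
      rw [Equiv.symm_apply_eq]
      simp [ss]
    rw [mem_inversions, Finset.mem_insert, Finset.mem_map_equiv, e, mem_inversions,
      Equiv.Perm.mul_apply, Equiv.Perm.mul_apply, Prod.mk.injEq]
    by_cases hpq : (p : ℕ) = k - 1 ∧ (q : ℕ) = k
    · have hp : p = ⟨k - 1, by omega⟩ := Fin.ext hpq.1
      have hq : q = ⟨k, h2⟩ := Fin.ext hpq.2
      have hlt : p < q := Fin.lt_def.mpr (by omega)
      have hw : w (s q) < w (s p) := by
        rw [(congrArg s hp).trans sa, (congrArg s hq).trans sb]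
        exact h
      exact ⟨fun _ => Or.inl ⟨hp, hq⟩, fun _ => ⟨hlt, hw⟩⟩
    · have h3 : ¬ (p = ⟨k - 1, by omega⟩ ∧ q = ⟨k, h2⟩) := by
        simpa [Fin.ext_iff] using hpq
      simp only [h3, false_or]
      constructor
      · rintro ⟨hlt, hw⟩
        exact ⟨adj_lt h1 h2 hlt hpq, hw⟩
      · rintro ⟨hlt, hw⟩
        refine ⟨?_, hw⟩
        have := adj_lt h1 h2 hlt (by
          rintro ⟨ha, hb⟩
          have ha' : s p = ⟨k - 1, by omega⟩ := Fin.ext ha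
          have hb' : s q = ⟨k, h2⟩ := Fin.ext hb
          rw [ha', hb'] at hw
          exact absurd h (not_lt.mpr hw.le))
        rwa [← hs, ss, ss] at this
  rw [key, Finset.card_insert_of_notMem, Finset.card_map]
  rw [Finset.mem_map_equiv]
  have e : (Equiv.prodCongr s s).symm ((⟨k - 1, by omega⟩ : Fin n), (⟨k, h2⟩ : Fin n))
      = (⟨k, h2⟩, ⟨k - 1, by omega⟩) := by
    rw [Equiv.symm_apply_eq]
    simp [sa, sb]
  rw [e, mem_inversions]
  rintro ⟨hlt, _⟩
  have := Fin.lt_def.mp hlt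
  simp only at this
  omega

theorem card_inv_mul_adj' {n k : ℕ} (h1 : 1 ≤ k) (h2 : k < n) (w : Equiv.Perm (Fin n))
    (h : w ⟨k, h2⟩ < w ⟨k - 1, by omega⟩) :
    (inversions w).card = (inversions (w * adj n k h1 h2)).card + 1 := by
  have := card_inv_mul_adj h1 h2 (w * adj n k h1 h2) (by simpa [adj] using h)
  rwa [mul_assoc, adj_mul_self, mul_one] at this

/-- The length function of `S_n` is the number of inversions. -/
theorem length_eq_card_inv {n : ℕ} (w : Equiv.Perm (Fin n)) :
    length (gens n) w = (inversions w).card := by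
  have lower : ∀ l : List (Equiv.Perm (Fin n)), (∀ s ∈ l, s ∈ gens n) →
      (inversions l.prod).card ≤ l.length := by
    intro l
    induction l using List.reverseRecOn with
    | nil =>
      intro _
      have : inversions (1 : Equiv.Perm (Fin n)) = ∅ := by
        ext ⟨a, b⟩
        rw [mem_inversions]
        simp only [Equiv.Perm.one_apply, Finset.notMem_empty, iff_false, not_and, not_lt]
        exact fun hab => hab.le
      simp [this]
    | append_singleton l s ih =>
      intro hl
      have h0 := ih (fun a ha => hl a (by simp [ha]))
      obtain ⟨k, h1, h2, rfl⟩ := hl s (by simp)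
      simp only [List.prod_append, List.prod_singleton, List.length_append, List.length_singleton]
      rcases lt_trichotomy (l.prod ⟨k - 1, by omega⟩) (l.prod ⟨k, h2⟩) with h | h | h
      · rw [card_inv_mul_adj h1 h2 _ h]; omega
      · have := l.prod.injective h
        simp [Fin.ext_iff] at this
        omega
      · have := card_inv_mul_adj' h1 h2 _ h; omega
  have upper : ∀ (m : ℕ) (w : Equiv.Perm (Fin n)), (inversions w).card = m →
      ∃ l : List (Equiv.Perm (Fin n)), (∀ s ∈ l, s ∈ gens n) ∧ l.prod = w ∧ l.length = m := by
    intro m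
    induction m with
    | zero =>
      intro w hw
      refine ⟨[], by simp, ?_, rfl⟩
      have hmono : StrictMono w := by
        intro a b hab
        by_contra hlt
        have hmem : (a, b) ∈ inversions w := by
          simp only [inversions, Finset.mem_filter, Finset.mem_univ, true_and]
          exact ⟨hab, lt_of_le_of_ne (not_lt.mp hlt) (fun h => hab.ne' (w.injective h))⟩
        rw [Finset.card_eq_zero.mp hw] at hmem
        simp at hmem
      have : (w : Fin n → Fin n) = id := by
        have h := Subsingleton.elim (hmono.orderIsoOfSurjective w w.surjective) (OrderIso.refl _)
        funext a
        exact congrArg (fun f : Fin n ≃o Fin n => f a) h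
      ext a
      simp [this]
    | succ m ih =>
      intro w hw
      have hex : ∃ (k : ℕ) (h1 : 1 ≤ k) (h2 : k < n), w ⟨k, h2⟩ < w ⟨k - 1, by omega⟩ := by
        by_contra hcon
        push Not at hcon
        have hmono : ∀ (d a : ℕ) (h : a + d < n), w ⟨a, by omega⟩ ≤ w ⟨a + d, h⟩ := by
          intro d
          induction d with
          | zero => intro a h; exact le_rfl
          | succ d ihd =>
            intro a h
            exact (ihd a (by omega)).trans (hcon (a + (d + 1)) (by omega) h)
        have : inversions w = ∅ := by
          ext ⟨a, b⟩
          simp only [inversions, Finset.mem_filter, Finset.mem_univ, true_and, Finset.notMem_empty,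
            iff_false, not_and, not_lt]
          intro hab
          have hab' : (a : ℕ) < b := hab
          have hd := hmono ((b : ℕ) - a) a (by omega)
          have e : (⟨(a : ℕ) + ((b : ℕ) - a), by omega⟩ : Fin n) = b := Fin.ext (by simp; omega)
          rwa [e] at hd
        simp [this] at hw
      obtain ⟨k, h1, h2, hk⟩ := hex
      have hc := card_inv_mul_adj' h1 h2 w hk
      obtain ⟨l, hl, hp, hlen⟩ := ih (w * adj n k h1 h2) (by omega)
      refine ⟨l ++ [adj n k h1 h2], ?_, ?_, by simp [hlen]⟩
      · intro s hs
        rcases List.mem_append.mp hs with h | h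
        · exact hl s h
        · rw [List.mem_singleton.mp h]
          exact ⟨k, h1, h2, rfl⟩
      · rw [List.prod_append, hp, List.prod_singleton, mul_assoc, adj_mul_self, mul_one]
  apply le_antisymm
  · exact Nat.sInf_le (upper _ w rfl)
  · obtain ⟨l, hl, hp, hk⟩ := Nat.sInf_mem
      (s := {k | ∃ l : List (Equiv.Perm (Fin n)),
        (∀ s ∈ l, s ∈ gens n) ∧ l.prod = w ∧ l.length = k}) ⟨_, upper _ w rfl⟩
    have := lower l hl
    rw [hp, hk] at this
    exact this

theorem card_inv_inv {n : ℕ} (w : Equiv.Perm (Fin n)) : (inversions w⁻¹).card = (inversions w).card := by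
  refine Finset.card_bij' (fun p _ => (w⁻¹ p.2, w⁻¹ p.1)) (fun p _ => (w p.2, w p.1)) ?_ ?_ ?_ ?_
  · rintro ⟨a, b⟩ h
    simp only [inversions, Finset.mem_filter, Finset.mem_univ, true_and] at h ⊢
    simpa using ⟨h.2, h.1⟩
  · rintro ⟨a, b⟩ h
    simp only [inversions, Finset.mem_filter, Finset.mem_univ, true_and] at h ⊢
    simpa using ⟨h.2, h.1⟩
  · rintro ⟨a, b⟩ _; simp
  · rintro ⟨a, b⟩ _; simp

/-- Right descents of a permutation. -/
theorem length_mul_adj_lt_iff {n k : ℕ} (h1 : 1 ≤ k) (h2 : k < n) (w : Equiv.Perm (Fin n)) :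
    length (gens n) (w * adj n k h1 h2) < length (gens n) w
      ↔ w ⟨k, h2⟩ < w ⟨k - 1, by omega⟩ := by
  rw [length_eq_card_inv, length_eq_card_inv]
  rcases lt_trichotomy (w ⟨k - 1, by omega⟩) (w ⟨k, h2⟩) with h | h | h
  · rw [card_inv_mul_adj h1 h2 _ h]
    exact ⟨fun h' => absurd h' (by omega), fun h' => absurd h' (not_lt.mpr h.le)⟩
  · have := w.injective h
    simp [Fin.ext_iff] at this
    omega
  · have := card_inv_mul_adj' h1 h2 _ h
    exact ⟨fun _ => h, fun _ => by omega⟩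

/-- `ℓ(s_k w) > ℓ(w)` if and only if `k` appears before `k + 1` in `w`. -/
theorem length_lt_adj_mul_iff {n k : ℕ} (h1 : 1 ≤ k) (h2 : k < n) (w : Equiv.Perm (Fin n)) :
    length (gens n) w < length (gens n) (adj n k h1 h2 * w)
      ↔ w⁻¹ ⟨k - 1, by omega⟩ < w⁻¹ ⟨k, h2⟩ := by
  have e : (adj n k h1 h2 * w)⁻¹ = w⁻¹ * adj n k h1 h2 := by
    rw [mul_inv_rev, inv_eq_of_mul_eq_one_left (adj_mul_self h1 h2)]
  rw [length_eq_card_inv, length_eq_card_inv, ← card_inv_inv w,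
    ← card_inv_inv (adj n k h1 h2 * w), e]
  rcases lt_trichotomy (w⁻¹ ⟨k - 1, by omega⟩) (w⁻¹ ⟨k, h2⟩) with h | h | h
  · rw [card_inv_mul_adj h1 h2 _ h]
    exact ⟨fun _ => h, fun _ => by omega⟩
  · have := w⁻¹.injective h
    simp [Fin.ext_iff] at this
    omega
  · have := card_inv_mul_adj' h1 h2 _ h
    exact ⟨fun h' => absurd h' (by omega), fun h' => absurd h' (not_lt.mpr h.le)⟩

theorem mul_mem_minReps {n : ℕ} {J : Set (Equiv.Perm (Fin n))} (hJ : J ⊆ gens n)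
    {v s : Equiv.Perm (Fin n)} (hv : v ∈ minReps (gens n) J)
    (hs : s ∈ rightDescents (gens n) v) : v * s ∈ minReps (gens n) J := by
  obtain ⟨⟨j, j1, j2, rfl⟩, hlt⟩ := hs
  rw [length_mul_adj_lt_iff] at hlt
  intro t ht
  obtain ⟨k, h1, h2, rfl⟩ := hJ ht
  have h := hv _ ht
  rw [length_lt_adj_mul_iff] at h ⊢
  have e : (v * adj n j j1 j2)⁻¹ = adj n j j1 j2 * v⁻¹ := by
    rw [mul_inv_rev, inv_eq_of_mul_eq_one_left (adj_mul_self j1 j2)]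
  rw [e, Equiv.Perm.mul_apply, Equiv.Perm.mul_apply]
  apply adj_lt j1 j2 h
  rintro ⟨ha, hb⟩
  have ha' : v⁻¹ ⟨k - 1, by omega⟩ = ⟨j - 1, by omega⟩ := Fin.ext ha
  have hb' : v⁻¹ ⟨k, h2⟩ = ⟨j, j2⟩ := Fin.ext hb
  rw [Equiv.Perm.inv_eq_iff_eq] at ha' hb'
  rw [← ha', ← hb', Fin.lt_def] at hlt
  simp only at hlt
  omega

/-- In `S_n`, a family with the characterizing property of the parabolic `R`-polynomials is given
by `parabolicR` on `W^J`; in particular, it is unique there. -/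
theorem IsParabolicRFamily.eq_parabolicR {n : ℕ} {J : Set (Equiv.Perm (Fin n))}
    (hJ : J ⊆ gens n) {x : ℤ[X]} {R : Equiv.Perm (Fin n) → Equiv.Perm (Fin n) → ℤ[X]}
    (hR : IsParabolicRFamily (gens n) J x R) :
    ∀ u ∈ minReps (gens n) J, ∀ v ∈ minReps (gens n) J,
      R u v = parabolicR (gens n) J x u v := by
  have main : ∀ (m : ℕ), ∀ v ∈ minReps (gens n) J, length (gens n) v = m →
      ∀ u ∈ minReps (gens n) J, R u v = parabolicR (gens n) J x u v := by
    intro m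
    induction m using Nat.strong_induction_on with
    | _ m ih =>
      intro v hv hm u hu
      by_cases huv : BruhatLE (gens n) u v
      · by_cases hne : u = v
        · subst hne
          rw [hR.eq_one u hu, parabolicR]
          simp [huv]
        · have hex : ∃ s, s ∈ rightDescents (gens n) v := by
            apply exists_rightDescent
            · rintro s ⟨k, h1, h2, rfl⟩
              exact adj_mul_self h1 h2
            · exact (Nat.zero_le _).trans_lt (length_lt_of_bruhat_ne huv hne)
          obtain ⟨s, hs, he⟩ := parabolicR_eq (gens n) J x u v huv hne hex
          rw [he, hR.eq_step u hu v hv huv hne s hs]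
          have hvs := mul_mem_minReps hJ hv hs
          have hl : length (gens n) (v * s) < m := hm ▸ hs.2
          unfold recursionStep
          split_ifs with ha hb
          · exact ih _ hl _ hvs rfl _ (mul_mem_minReps hJ hu ha)
          · rw [ih _ hl _ hvs rfl _ hb, ih _ hl _ hvs rfl _ hu]
          · rw [ih _ hl _ hvs rfl _ hu]
      · rw [hR.eq_zero u hu v hv huv, parabolicR]
        simp [huv]
  exact fun u hu v hv => main _ v hv rfl u hu

end Facts

section Statistics

variable {n : ℕ}

/-- `A(u,v)`: the letters `t ∈ {i-1, i}` whose position in `u` is at least their position in `v`.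
(The letter `t : Fin n` stands for the number `t + 1`.) -/
def setA (i : ℕ) (u v : Equiv.Perm (Fin n)) : Finset (Fin n) :=
  Finset.univ.filter fun t =>
    ((t : ℕ) + 1 = i - 1 ∨ (t : ℕ) + 1 = i) ∧ u⁻¹ t ≥ v⁻¹ t

/-- `B(u,v) = {1, …, i-2} ∪ A(u,v)`. -/
def setB (i : ℕ) (u v : Equiv.Perm (Fin n)) : Finset (Fin n) :=
  (Finset.univ.filter fun t => (t : ℕ) + 1 ≤ i - 2) ∪ setA i u v

/-- `a_j(u,v) = |{r ∈ u⁻¹(B(u,v)) | r < j}| - |{r ∈ v⁻¹(B(u,v)) | r < j}|`. -/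
def statA (i : ℕ) (u v : Equiv.Perm (Fin n)) (j : Fin n) : ℤ :=
  ((Finset.univ.filter fun r => u r ∈ setB i u v ∧ r < j).card : ℤ)
    - ((Finset.univ.filter fun r => v r ∈ setB i u v ∧ r < j).card : ℤ)

/-- `D(u,v) = v⁻¹(B(u,v)) \ u⁻¹(B(u,v))`. -/
def setD (i : ℕ) (u v : Equiv.Perm (Fin n)) : Finset (Fin n) :=
  Finset.univ.filter fun j => v j ∈ setB i u v ∧ u j ∉ setB i u v

/-- The factor `1 - q + δ_{u⁻¹(t),v⁻¹(t)} q^{1 + a_{v⁻¹(t)}(u,v)}`, with `q = T`. Laurent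
polynomials are used because the exponents are integers. -/
noncomputable def factor (i : ℕ) (u v : Equiv.Perm (Fin n)) (t : Fin n) : ℤ[T;T⁻¹] :=
  1 - LaurentPolynomial.T 1
    + if u⁻¹ t = v⁻¹ t then LaurentPolynomial.T (1 + statA i u v (v⁻¹ t)) else 0

end Statistics

end ParabolicKL

namespace ParabolicKL

/-! ### Lifting property of the Bruhat order on the symmetric group. -/

section Bruhat

variable {n : ℕ}

/-! The product `F` splits over positions. Each position `j` carries a weight: the factor `1 - q + δ
q^(1+a)` if `v j` is one of the letters `i-1`, `i`, times `1 - q^a` if `j` lies in `D(u,v)`. By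
`prod_weight_eq`, the product of all weights is `F`. After removing the sign `(-1)^(ℓ(v)-ℓ(u))`, or
substituting `1/q` and removing the power of `q`, both recursions for the parabolic `R`-polynomials
become the same one: along a right descent `s` of `v`, `F u v` is `F (us) (vs)`, or `q F (us) (vs) +
(1-q) F u (vs)`, or `F u (vs)`.

This common recursion is local. Let `s` exchange the adjacent positions `κ` and `μ = κ + 1`.
Exchanging the entries of `u` or of `v` there changes membership in `B` only for a letter lying in
this window in both permutations. Such a letter cancels in the window's total contribution to `a`,
so nothing outside the window changes (`prod_weight_swap`). Inside it only the classes of four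
entries matter (at most `i-2`, equal to `i-1`, equal to `i`, above `i`), together with two flags
telling whether `i-1` and `i` belong to `B`. The recursion is thus a finite list of polynomial
identities in `q` and one further variable: `windowWeight_descent`, `windowWeight_ascent`,
`windowWeight_level`. The assumption that `i-1` precedes `i` in `v` restricts the configurations
(`window_constraints`) and survives passing from `v` to `vs`, so induction on `ℓ(v)` applies.

The `R`-polynomials vanish unless `u ≤ v`, so `F` must vanish there too. This follows from the same
recursion and the lifting property; for `v = 1` the first position not fixed by `u` contributes `1 -
q^0 = 0`. -/

theorem swap_eq_of_mem_reflections {t : Equiv.Perm (Fin n)} (ht : t ∈ reflections (gens n)) :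
    ∃ p q : Fin n, p < q ∧ t = Equiv.swap p q := by
  obtain ⟨w, s, ⟨k, h1, h2, rfl⟩, rfl⟩ := ht
  have hne : w ⟨k - 1, by omega⟩ ≠ w ⟨k, h2⟩ := by
    intro h
    have := congrArg Fin.val (w.injective h)
    simp only at this
    omega
  rw [adj, ← Equiv.swap_apply_apply]
  rcases lt_or_gt_of_ne hne with h | h
  · exact ⟨_, _, h, rfl⟩
  · exact ⟨_, _, h, Equiv.swap_comm _ _⟩

theorem conj_mem_reflections {W : Type*} [Group W] {S : Set W} {t : W} (ht : t ∈ reflections S)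
    (g : W) : g * t * g⁻¹ ∈ reflections S := by
  obtain ⟨w, s, hs, rfl⟩ := ht
  exact ⟨g * w, s, hs, by group⟩

theorem mem_reflections_of_mem {W : Type*} [Group W] {S : Set W} {s : W} (hs : s ∈ S) :
    s ∈ reflections S :=
  ⟨1, s, hs, by simp⟩

/-- Multiplying on the right by a transposition that creates an inversion increases the length. -/
theorem length_lt_mul_swap {w : Equiv.Perm (Fin n)} {p q : Fin n} (hpq : p < q)
    (hw : w p < w q) : length (gens n) w < length (gens n) (w * Equiv.swap p q) := by
  rw [length_eq_card_inv, length_eq_card_inv]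
  set t := Equiv.swap p q with ht
  have tt : ∀ a, t (t a) = a := fun a => by simp [ht]
  -- `f` carries a pair of positions along `t` when `t` keeps its order and fixes it otherwise. It
  -- injects the inversions of `w` into those of `w * t` and misses `(p, q)`.
  set f : Fin n × Fin n → Fin n × Fin n := fun x => if t x.1 < t x.2 then (t x.1, t x.2) else x
    with hf
  have key : ∀ a b : Fin n, a < b → t b ≤ t a → w b < w a → w (t b) < w (t a) ∧ (a, b) ≠ (p, q) := by
    intro a b hab htab hba
    refine ⟨?_, ?_⟩
    · rw [ht, Equiv.swap_apply_def, Equiv.swap_apply_def] at htab ⊢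
      split_ifs at htab ⊢ <;> subst_vars <;> order
    · rintro h
      rw [Prod.mk.injEq] at h
      rw [h.1, h.2] at hba
      order
  have hsub : insert (p, q) ((inversions w).image f) ⊆ inversions (w * t) := by
    intro x hx
    rcases Finset.mem_insert.mp hx with rfl | hx
    · rw [mem_inversions]
      simpa [ht] using ⟨hpq, hw⟩
    · obtain ⟨⟨a, b⟩, hab, rfl⟩ := Finset.mem_image.mp hx
      rw [mem_inversions] at hab
      simp only [hf]
      split_ifs with h
      · rw [mem_inversions]
        simpa [tt] using ⟨h, hab.2⟩
      · rw [mem_inversions]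
        exact ⟨hab.1, (key a b hab.1 (not_lt.mp h) hab.2).1⟩
  have hinj : Set.InjOn f (inversions w) := by
    rintro ⟨a, b⟩ hab ⟨c, d⟩ hcd h
    rw [Finset.mem_coe, mem_inversions] at hab hcd
    simp only [hf] at h
    split_ifs at h with h1 h2 h2
    · simpa using h
    · rw [Prod.mk.injEq] at h
      rw [← h.1, ← h.2, tt, tt] at h2
      exact absurd hab.1 h2
    · rw [Prod.mk.injEq] at h
      rw [h.1, h.2, tt, tt] at h1
      exact absurd hcd.1 h1
    · exact h
  have hnot : (p, q) ∉ (inversions w).image f := by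
    intro hx
    obtain ⟨⟨a, b⟩, hab, h⟩ := Finset.mem_image.mp hx
    rw [mem_inversions] at hab
    simp only [hf] at h
    split_ifs at h with h1
    · rw [Prod.mk.injEq] at h
      have ha : a = q := by rw [← tt a, h.1, ht, Equiv.swap_apply_left]
      have hb : b = p := by rw [← tt b, h.2, ht, Equiv.swap_apply_right]
      rw [ha, hb] at hab
      order
    · exact (key a b hab.1 (not_lt.mp h1) hab.2).2 h
  have := Finset.card_le_card hsub
  rw [Finset.card_insert_of_notMem hnot, Finset.card_image_of_injOn hinj] at this
  omega

theorem lt_of_length_lt_mul_swap {w : Equiv.Perm (Fin n)} {p q : Fin n} (hpq : p < q)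
    (h : length (gens n) w < length (gens n) (w * Equiv.swap p q)) : w p < w q := by
  by_contra hlt
  have hlt' : w q < w p := lt_of_le_of_ne (not_lt.mp hlt) fun e => hpq.ne' (w.injective e)
  have := length_lt_mul_swap (w := w * Equiv.swap p q) hpq (by simpa using hlt')
  rw [mul_assoc, Equiv.swap_mul_self, mul_one] at this
  omega

/-- Follow a chain from `a` to `b`. Conjugation by `s` turns each step by `t ≠ s` into another
length-increasing step, since `s` preserves the order of every pair of positions other than its own.
A step by `s` itself leads from the second alternative to the first. -/
theorem bruhatLE_mul_adj {k : ℕ} (h1 : 1 ≤ k) (h2 : k < n) {a b : Equiv.Perm (Fin n)}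
    (hab : BruhatLE (gens n) a b) :
    BruhatLE (gens n) (a * adj n k h1 h2) b
      ∨ BruhatLE (gens n) (a * adj n k h1 h2) (b * adj n k h1 h2) := by
  set s := adj n k h1 h2 with hs
  have ss : s * s = 1 := adj_mul_self h1 h2
  have si : s⁻¹ = s := inv_eq_of_mul_eq_one_left ss
  induction hab with
  | refl => exact Or.inr Relation.ReflTransGen.refl
  | @tail b c hab hbc ih =>
    obtain ⟨t, ht, rfl, hlt⟩ := hbc
    rcases ih with ih | ih
    · exact Or.inl (ih.tail ⟨t, ht, rfl, hlt⟩)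
    · obtain ⟨p, q, hpq, rfl⟩ := swap_eq_of_mem_reflections ht
      by_cases hk : (p : ℕ) = k - 1 ∧ (q : ℕ) = k
      · left
        have : Equiv.swap p q = s := by
          rw [hs, adj]
          congr 1 <;> exact Fin.ext (by simp [hk])
        rwa [this]
      · right
        refine ih.tail ⟨s * Equiv.swap p q * s⁻¹, conj_mem_reflections ht s, ?_, ?_⟩
        · rw [si]
          calc b * Equiv.swap p q * s = b * (s * s) * Equiv.swap p q * s := by rw [ss, mul_one]
            _ = _ := by simp only [mul_assoc]
        · have e : b * Equiv.swap p q * s = b * s * Equiv.swap (s p) (s q) := by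
            rw [Equiv.swap_apply_apply, si]
            calc b * Equiv.swap p q * s = b * (s * s) * Equiv.swap p q * s := by rw [ss, mul_one]
              _ = _ := by simp only [mul_assoc]
          rw [e]
          apply length_lt_mul_swap (adj_lt h1 h2 hpq hk)
          have hsa : ∀ x, s (s x) = x := fun x => by
            rw [← Equiv.Perm.mul_apply, ss, Equiv.Perm.one_apply]
          rw [← hs, Equiv.Perm.mul_apply, Equiv.Perm.mul_apply, hsa, hsa]
          exact lt_of_length_lt_mul_swap hpq hlt

theorem bruhatLE_of_rightDescent {W : Type*} [Group W] {S : Set W} (hS : ∀ s ∈ S, s * s = 1)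
    {v s : W} (hs : s ∈ rightDescents S v) : BruhatLE S (v * s) v :=
  Relation.ReflTransGen.single ⟨s, mem_reflections_of_mem hs.1, by
    rw [mul_assoc, hS s hs.1, mul_one], hs.2⟩

theorem gens_mul_self {s : Equiv.Perm (Fin n)} (hs : s ∈ gens n) : s * s = 1 := by
  obtain ⟨k, h1, h2, rfl⟩ := hs
  exact adj_mul_self h1 h2

/-- The lifting property of the Bruhat order. -/
theorem bruhatLE_of_mul_le_mul {u v s : Equiv.Perm (Fin n)}
    (hv : s ∈ rightDescents (gens n) v) (h : BruhatLE (gens n) (u * s) (v * s)) :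
    BruhatLE (gens n) u v := by
  obtain ⟨k, h1, h2, rfl⟩ := hv.1
  have hle := bruhatLE_of_rightDescent (fun _ => gens_mul_self) hv
  have := bruhatLE_mul_adj h1 h2 h
  rw [mul_assoc, mul_assoc, adj_mul_self, mul_one, mul_one] at this
  rcases this with h | h
  · exact h.trans hle
  · exact h

end Bruhat

/-! ### The recursion as finitely many identities on two adjacent positions. -/

section Window

/-- Whether the letter class `t` counts as being weakly to the right in `u` of its place in `v`:
decided inside the window `(p, p')` over `(r, r')` if the letter occurs in both rows of it, and
equal to `g` otherwise. -/
def windowFlag (t p p' r r' : Fin 4) (g : Bool) : Bool :=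
  if (p = t ∨ p' = t) ∧ (r = t ∨ r' = t) then decide (¬ (p = t ∧ r' = t)) else g

/-- Membership of the letter class `c` in the set `B`, seen from a window. -/
def windowMem (p p' r r' : Fin 4) (g₁ g₂ : Bool) (c : Fin 4) : Bool :=
  decide (c = 0) || (decide (c = 1) && windowFlag 1 p p' r r' g₁)
    || (decide (c = 2) && windowFlag 2 p p' r r' g₂)

variable {R : Type*} [CommRing R]

/-- The contribution of a position with letter classes `p` (in `u`) and `r` (in `v`), where `x`
stands for `q ^ a`. -/
def localWeight (Q : R) (p r : Fin 4) (bp br : Bool) (x : R) : R :=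
  (if r = 1 ∨ r = 2 then 1 - Q + (if p = r then Q * x else 0) else 1)
    * (if br = true ∧ bp = false then 1 - x else 1)

/-- The contribution of two adjacent positions, where `z` stands for `q ^ (a - 1)`. -/
def windowWeight (Q z : R) (p p' r r' : Fin 4) (g₁ g₂ : Bool) : R :=
  localWeight Q p r (windowMem p p' r r' g₁ g₂ p) (windowMem p p' r r' g₁ g₂ r) (z * Q)
    * localWeight Q p' r' (windowMem p p' r r' g₁ g₂ p') (windowMem p p' r r' g₁ g₂ r')
      (z * Q ^ (1 + (windowMem p p' r r' g₁ g₂ p).toNat - (windowMem p p' r r' g₁ g₂ r).toNat))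

/-- The case `s ∈ D_R(u)`. A finite check over classes and flags; since `z` stands for `q ^ (a -
1)`, all exponents are natural numbers and `ring` suffices. The hypotheses on `g₁`, `g₂` are those
supplied by `window_constraints`. -/
theorem windowWeight_descent (Q z : R) {p p' r r' : Fin 4} (g₁ g₂ : Bool) (hp : p' < p)
    (hr : r' < r) (h : ¬ (r = 2 ∧ r' = 1))
    (hg₁ : r = 2 ∨ r' = 2 → p = 1 ∨ p' = 1 → g₁ = true)
    (hg₂ : r = 1 ∨ r' = 1 → p = 2 ∨ p' = 2 → g₂ = false)
    (hg₁₂ : p = 1 ∨ p' = 1 → p = 2 ∨ p' = 2 → g₂ = true → g₁ = true) :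
    windowWeight Q z p p' r r' g₁ g₂ = windowWeight Q z p' p r' r g₁ g₂ := by
  fin_cases r <;> fin_cases r' <;> first
    | exact absurd hr (by decide)
    | exact absurd ⟨rfl, rfl⟩ h
    | (fin_cases p <;> fin_cases p' <;> first
        | exact absurd hp (by decide)
        | (cases g₁ <;> cases g₂ <;> first
          | exact absurd (hg₁ (by decide) (by decide)) (by decide)
          | exact absurd (hg₂ (by decide) (by decide)) (by decide)
          | exact absurd (hg₁₂ (by decide) (by decide) rfl) (by decide)
          | (simp [windowWeight, localWeight, windowMem, windowFlag] <;> ring)))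

/-- The case `s ∉ D_R(u)`, `us ∈ W^J`: exchanging both rows corresponds to `(us, vs)`, exchanging
only the lower row to `(u, vs)`. -/
theorem windowWeight_ascent (Q z : R) {p p' r r' : Fin 4} (g₁ g₂ : Bool) (hp : p < p')
    (hr : r' < r) (h : ¬ (r = 2 ∧ r' = 1))
    (hg₁ : r = 2 ∨ r' = 2 → p = 1 ∨ p' = 1 → g₁ = true)
    (hg₂ : r = 1 ∨ r' = 1 → p = 2 ∨ p' = 2 → g₂ = false)
    (hg₁₂ : p = 1 ∨ p' = 1 → p = 2 ∨ p' = 2 → g₂ = true → g₁ = true) :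
    windowWeight Q z p p' r r' g₁ g₂
      = Q * windowWeight Q z p' p r' r g₁ g₂ + (1 - Q) * windowWeight Q z p p' r' r g₁ g₂ := by
  fin_cases r <;> fin_cases r' <;> first
    | exact absurd hr (by decide)
    | exact absurd ⟨rfl, rfl⟩ h
    | (fin_cases p <;> fin_cases p' <;> first
        | exact absurd hp (by decide)
        | (cases g₁ <;> cases g₂ <;> first
          | exact absurd (hg₁ (by decide) (by decide)) (by decide)
          | exact absurd (hg₂ (by decide) (by decide)) (by decide)
          | exact absurd (hg₁₂ (by decide) (by decide) rfl) (by decide)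
          | (simp [windowWeight, localWeight, windowMem, windowFlag] <;> ring)))

/-- The case `us ∉ W^J`, where the two entries of `u` have the same class. Neither of them is then
`i-1` or `i`, so no special letter occurs in both rows and no condition on the flags is needed. -/
theorem windowWeight_level (Q z : R) {p r r' : Fin 4} (g₁ g₂ : Bool) (hp : p = 0 ∨ p = 3)
    (hr : r' < r) (h : ¬ (r = 2 ∧ r' = 1)) :
    windowWeight Q z p p r r' g₁ g₂ = windowWeight Q z p p r' r g₁ g₂ := by
  fin_cases r <;> fin_cases r' <;> first
    | exact absurd hr (by decide)
    | exact absurd ⟨rfl, rfl⟩ h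
    | (rcases hp with rfl | rfl <;> cases g₁ <;> cases g₂ <;>
        (simp [windowWeight, localWeight, windowMem, windowFlag] <;> ring))

end Window

/-! ### Effect of an exchange of adjacent entries on `B`, on `a_j` and on the weights. -/

section Locality

variable {n : ℕ}

/-- The class of a letter: `0` for the letters up to `i - 2`, `1` for `i - 1`, `2` for `i`, and `3`
for the letters above `i`. -/
def letterClass (i : ℕ) (c : Fin n) : Fin 4 :=
  if (c : ℕ) + 1 ≤ i - 2 then 0 else if (c : ℕ) + 1 = i - 1 then 1
    else if (c : ℕ) + 1 = i then 2 else 3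

theorem letterClass_eq_zero_iff {i : ℕ} {c : Fin n} :
    letterClass i c = 0 ↔ (c : ℕ) + 1 ≤ i - 2 := by
  unfold letterClass
  split_ifs <;> simp_all

theorem letterClass_eq_one_iff {i : ℕ} (hi : 3 ≤ i) {c : Fin n} :
    letterClass i c = 1 ↔ (c : ℕ) + 1 = i - 1 := by
  unfold letterClass
  split_ifs <;> simp <;> omega

theorem letterClass_eq_two_iff {i : ℕ} (hi : 3 ≤ i) {c : Fin n} :
    letterClass i c = 2 ↔ (c : ℕ) + 1 = i := by
  unfold letterClass
  split_ifs <;> simp <;> omega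

theorem letterClass_eq_three_iff {i : ℕ} (hi : 3 ≤ i) {c : Fin n} :
    letterClass i c = 3 ↔ i ≤ (c : ℕ) := by
  unfold letterClass
  split_ifs <;> simp <;> omega

theorem letterClass_mono {i : ℕ} {c d : Fin n} (h : c ≤ d) : letterClass i c ≤ letterClass i d := by
  have h' := Fin.le_def.mp h
  unfold letterClass
  split_ifs <;> first | decide | (exfalso; omega)

/-- Outside the classes `0` and `3`, the class determines the letter. -/
theorem letterClass_eq_iff {i : ℕ} (hi : 3 ≤ i) {c d : Fin n}
    (h : letterClass i d = 1 ∨ letterClass i d = 2) :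
    letterClass i c = letterClass i d ↔ c = d := by
  refine ⟨fun e => ?_, fun e => by rw [e]⟩
  rcases h with h | h <;> rw [h] at e
  · rw [letterClass_eq_one_iff hi] at e h
    exact Fin.ext (by omega)
  · rw [letterClass_eq_two_iff hi] at e h
    exact Fin.ext (by omega)

theorem mem_setB_iff {i : ℕ} (hi : 3 ≤ i) {u v : Equiv.Perm (Fin n)} {c : Fin n} :
    c ∈ setB i u v ↔ letterClass i c = 0
      ∨ ((letterClass i c = 1 ∨ letterClass i c = 2) ∧ v⁻¹ c ≤ u⁻¹ c) := by
  rw [letterClass_eq_zero_iff, letterClass_eq_one_iff hi, letterClass_eq_two_iff hi]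
  simp [setB, setA]

theorem mem_setB_iff_of_special {i : ℕ} (hi : 3 ≤ i) {u v : Equiv.Perm (Fin n)} {c : Fin n}
    (h : letterClass i c = 1 ∨ letterClass i c = 2) : c ∈ setB i u v ↔ v⁻¹ c ≤ u⁻¹ c := by
  rw [mem_setB_iff hi]
  rcases h with h | h <;> simp [h]

/-- The contribution of the position `j` to the product in the theorem. -/
noncomputable def weight (i : ℕ) (u v : Equiv.Perm (Fin n)) (j : Fin n) : ℤ[T;T⁻¹] :=
  localWeight (LaurentPolynomial.T 1) (letterClass i (u j)) (letterClass i (v j))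
    (decide (u j ∈ setB i u v)) (decide (v j ∈ setB i u v)) (LaurentPolynomial.T (statA i u v j))

theorem statA_eq_sum (i : ℕ) (u v : Equiv.Perm (Fin n)) (j : Fin n) :
    statA i u v j = ∑ r with r < j,
      (((decide (u r ∈ setB i u v)).toNat : ℤ) - ((decide (v r ∈ setB i u v)).toNat : ℤ)) := by
  have key : ∀ w : Equiv.Perm (Fin n),
      ((Finset.univ.filter fun r => w r ∈ setB i u v ∧ r < j).card : ℤ)
        = ∑ r with r < j, ((decide (w r ∈ setB i u v)).toNat : ℤ) := by
    intro w
    have : (Finset.univ.filter fun r => w r ∈ setB i u v ∧ r < j)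
        = (Finset.univ.filter fun r => r < j).filter fun r => w r ∈ setB i u v := by
      ext r
      simp [and_comm]
    rw [this, Finset.card_filter]
    push_cast
    refine Finset.sum_congr rfl fun r _ => ?_
    by_cases h : w r ∈ setB i u v <;> simp [h]
  rw [statA, key, key, Finset.sum_sub_distrib]

/-- A special letter present in both rows contributes zero to the difference, whatever its flag; all
other memberships ignore the order inside the window. The hypotheses say that no special letter
occurs twice in a row. -/
theorem windowMem_sum_swap : ∀ (p p' r r' : Fin 4) (g₁ g₂ : Bool),
    (p = p' → p = 0 ∨ p = 3) → (r = r' → r = 0 ∨ r = 3) →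
    ((((windowMem p p' r r' g₁ g₂ p).toNat : ℤ) + (windowMem p p' r r' g₁ g₂ p').toNat
        - (windowMem p p' r r' g₁ g₂ r).toNat - (windowMem p p' r r' g₁ g₂ r').toNat
      = (windowMem p p' r' r g₁ g₂ p).toNat + (windowMem p p' r' r g₁ g₂ p').toNat
        - (windowMem p p' r' r g₁ g₂ r).toNat - (windowMem p p' r' r g₁ g₂ r').toNat)
    ∧ (((windowMem p p' r r' g₁ g₂ p).toNat : ℤ) + (windowMem p p' r r' g₁ g₂ p').toNat
        - (windowMem p p' r r' g₁ g₂ r).toNat - (windowMem p p' r r' g₁ g₂ r').toNat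
      = (windowMem p' p r r' g₁ g₂ p).toNat + (windowMem p' p r r' g₁ g₂ p').toNat
        - (windowMem p' p r r' g₁ g₂ r).toNat - (windowMem p' p r r' g₁ g₂ r').toNat)) := by
  decide +kernel

variable {κ μ : Fin n}

/-- `w'` is `w` up to exchanging the entries at the positions `κ` and `μ`. -/
def SwapRel (κ μ : Fin n) (w w' : Equiv.Perm (Fin n)) : Prop :=
  w' = w ∨ w' = w * Equiv.swap κ μ

theorem SwapRel.apply_eq {w w' : Equiv.Perm (Fin n)} (h : SwapRel κ μ w w') {j : Fin n}
    (h1 : j ≠ κ) (h2 : j ≠ μ) : w' j = w j := by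
  rcases h with rfl | rfl
  · rfl
  · rw [Equiv.Perm.mul_apply, Equiv.swap_apply_of_ne_of_ne h1 h2]

theorem SwapRel.inv_apply {w w' : Equiv.Perm (Fin n)} (h : SwapRel κ μ w w') (c : Fin n) :
    (w'⁻¹ c = w⁻¹ c ∧ w⁻¹ c ≠ κ ∧ w⁻¹ c ≠ μ)
      ∨ ((w'⁻¹ c = κ ∨ w'⁻¹ c = μ) ∧ (w⁻¹ c = κ ∨ w⁻¹ c = μ)) := by
  rcases h with rfl | rfl
  · tauto
  · rw [mul_inv_rev, Equiv.swap_inv, Equiv.Perm.mul_apply]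
    by_cases h1 : w⁻¹ c = κ
    · simp [h1]
    · by_cases h2 : w⁻¹ c = μ
      · simp [h2]
      · left
        exact ⟨Equiv.swap_apply_of_ne_of_ne h1 h2, h1, h2⟩

/-- If one of the two positions of `c` stays outside the window, moving the other between `κ` and `κ
+ 1` cannot change their comparison. -/
theorem mem_setB_swap {i : ℕ} (hi : 3 ≤ i) (hκμ : (μ : ℕ) = κ + 1) {u u' v v' : Equiv.Perm (Fin n)}
    (hu : SwapRel κ μ u u') (hv : SwapRel κ μ v v') {c : Fin n}
    (h : ¬ ((u'⁻¹ c = κ ∨ u'⁻¹ c = μ) ∧ (v'⁻¹ c = κ ∨ v'⁻¹ c = μ))) :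
    c ∈ setB i u' v' ↔ c ∈ setB i u v := by
  rw [mem_setB_iff hi, mem_setB_iff hi]
  have hu' := hu.inv_apply c
  have hv' := hv.inv_apply c
  have : v'⁻¹ c ≤ u'⁻¹ c ↔ v⁻¹ c ≤ u⁻¹ c := by
    simp only [Fin.ext_iff, Fin.le_def, ne_eq] at *
    omega
  rw [this]

theorem decide_mem_setB_eq_windowFlag {i : ℕ} (hi : 3 ≤ i) (hκμ : (μ : ℕ) = κ + 1)
    {u u' v v' : Equiv.Perm (Fin n)} (hu : SwapRel κ μ u u') (hv : SwapRel κ μ v v') {t : Fin n}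
    (ht : letterClass i t = 1 ∨ letterClass i t = 2) :
    decide (t ∈ setB i u' v') = windowFlag (letterClass i t) (letterClass i (u' κ))
      (letterClass i (u' μ)) (letterClass i (v' κ)) (letterClass i (v' μ))
      (decide (t ∈ setB i u v)) := by
  have e : ∀ (w : Equiv.Perm (Fin n)) (j : Fin n),
      letterClass i (w j) = letterClass i t ↔ w⁻¹ t = j := by
    intro w j
    rw [letterClass_eq_iff hi ht, Equiv.Perm.inv_eq_iff_eq, eq_comm]
  simp only [windowFlag, e]
  split_ifs with h
  · rw [decide_eq_decide, mem_setB_iff_of_special hi ht]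
    simp only [Fin.ext_iff, Fin.le_def] at *
    omega
  · rw [decide_eq_decide]
    exact mem_setB_swap hi hκμ hu hv h

theorem decide_mem_setB_eq_windowMem {i : ℕ} (hi : 3 ≤ i) (hκμ : (μ : ℕ) = κ + 1)
    {u u' v v' : Equiv.Perm (Fin n)} (hu : SwapRel κ μ u u') (hv : SwapRel κ μ v v')
    {x y : Fin n} (hx : letterClass i x = 1) (hy : letterClass i y = 2) (c : Fin n) :
    decide (c ∈ setB i u' v') = windowMem (letterClass i (u' κ))
      (letterClass i (u' μ)) (letterClass i (v' κ)) (letterClass i (v' μ))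
      (decide (x ∈ setB i u v)) (decide (y ∈ setB i u v)) (letterClass i c) := by
  have hfx := decide_mem_setB_eq_windowFlag hi hκμ hu hv (Or.inl hx)
  have hfy := decide_mem_setB_eq_windowFlag hi hκμ hu hv (Or.inr hy)
  rw [hx] at hfx
  rw [hy] at hfy
  rw [windowMem, ← hfx, ← hfy]
  by_cases h0 : letterClass i c = 0
  · simp [h0, mem_setB_iff hi]
  · by_cases h1 : letterClass i c = 1
    · have : c = x := (letterClass_eq_iff hi (Or.inl hx)).mp (h1.trans hx.symm)
      subst this
      simp [h1]
    · by_cases h2 : letterClass i c = 2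
      · have : c = y := (letterClass_eq_iff hi (Or.inr hy)).mp (h2.trans hy.symm)
        subst this
        simp [h2]
      · simp [h0, h1, h2, mem_setB_iff hi]

theorem letterClass_eq_zero_or_three {i : ℕ} (hi : 3 ≤ i) (w : Equiv.Perm (Fin n)) {a b : Fin n}
    (hab : a ≠ b) (h : letterClass i (w a) = letterClass i (w b)) :
    letterClass i (w a) = 0 ∨ letterClass i (w a) = 3 := by
  by_contra hcon
  have h12 : letterClass i (w a) = 1 ∨ letterClass i (w a) = 2 := by
    revert hcon
    generalize letterClass i (w a) = c
    revert c
    decide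
  rw [h] at h12
  exact hab (w.injective ((letterClass_eq_iff hi h12).mp h))

theorem SwapRel.refl (w : Equiv.Perm (Fin n)) : SwapRel κ μ w w := Or.inl rfl

theorem decide_mem_setB_swap_of_ne {i : ℕ} (hi : 3 ≤ i) (hκμ : (μ : ℕ) = κ + 1)
    {u u' v v' : Equiv.Perm (Fin n)} (hu : SwapRel κ μ u u') (hv : SwapRel κ μ v v')
    {j : Fin n} (h1 : j ≠ κ) (h2 : j ≠ μ) :
    decide (u' j ∈ setB i u' v') = decide (u j ∈ setB i u v)
      ∧ decide (v' j ∈ setB i u' v') = decide (v j ∈ setB i u v) := by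
  refine ⟨?_, ?_⟩ <;> rw [decide_eq_decide]
  · rw [mem_setB_swap hi hκμ hu hv (by simp [h1, h2]), hu.apply_eq h1 h2]
  · rw [mem_setB_swap hi hκμ hu hv (by simp [h1, h2]), hv.apply_eq h1 h2]

/-- An initial segment of positions ending before `j ≠ μ` contains both `κ` and `μ` or neither. -/
theorem sum_lt_eq_of_window (hκμ : (μ : ℕ) = κ + 1) {f g : Fin n → ℤ}
    (hfg : ∀ r, r ≠ κ → r ≠ μ → f r = g r) (hw : f κ + f μ = g κ + g μ) {j : Fin n} (hj : j ≠ μ) :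
    ∑ r with r < j, f r = ∑ r with r < j, g r := by
  have hj' : (j : ℕ) ≠ μ := fun h => hj (Fin.ext h)
  by_cases hlt : κ < j
  · have hlt' := Fin.lt_def.mp hlt
    have hκ : κ ∈ Finset.univ.filter (· < j) := by simpa using hlt
    have hμ : μ ∈ (Finset.univ.filter (· < j)).erase κ := by
      simp only [Finset.mem_erase, Finset.mem_filter, Finset.mem_univ, true_and, Fin.lt_def, ne_eq,
        Fin.ext_iff]
      omega
    rw [← Finset.add_sum_erase _ _ hκ, ← Finset.add_sum_erase _ _ hκ,
      ← Finset.add_sum_erase _ _ hμ, ← Finset.add_sum_erase _ _ hμ, ← add_assoc, ← add_assoc, hw]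
    congr 1
    refine Finset.sum_congr rfl fun r hr => ?_
    simp only [Finset.mem_erase] at hr
    exact hfg r hr.2.1 hr.1
  · refine Finset.sum_congr rfl fun r hr => ?_
    have hr' := (Finset.mem_filter.mp hr).2
    simp only [Fin.lt_def] at hr' hlt
    exact hfg r (fun h => by rw [h] at hr'; omega) (fun h => by rw [h] at hr'; omega)

theorem statA_swap {i : ℕ} (hi : 3 ≤ i) (hκμ : (μ : ℕ) = κ + 1)
    {u u' v v' : Equiv.Perm (Fin n)} (hu : SwapRel κ μ u u') (hv : SwapRel κ μ v v')
    {x y : Fin n} (hx : letterClass i x = 1) (hy : letterClass i y = 2) {j : Fin n}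
    (hj : j ≠ μ) : statA i u' v' j = statA i u v j := by
  rw [statA_eq_sum, statA_eq_sum]
  refine sum_lt_eq_of_window hκμ (fun r h1 h2 => ?_) ?_ hj
  · obtain ⟨e1, e2⟩ := decide_mem_setB_swap_of_ne hi hκμ hu hv h1 h2
    rw [e1, e2]
  · have hne : κ ≠ μ := fun h => by rw [h] at hκμ; omega
    have hp := letterClass_eq_zero_or_three hi u hne
    have hr := letterClass_eq_zero_or_three hi v hne
    have hr' := letterClass_eq_zero_or_three hi v hne.symm
    have m := decide_mem_setB_eq_windowMem hi hκμ (SwapRel.refl u) (SwapRel.refl v) hx hy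
    have m' := decide_mem_setB_eq_windowMem hi hκμ hu hv hx hy
    generalize decide (x ∈ setB i u v) = g₁ at m m'
    generalize decide (y ∈ setB i u v) = g₂ at m m'
    rw [m, m, m, m, m', m', m', m']
    have s1 := windowMem_sum_swap _ _ _ _ g₁ g₂ hp hr
    have s2 := windowMem_sum_swap _ _ _ _ g₁ g₂ hp hr'
    rcases hu with rfl | rfl <;> rcases hv with rfl | rfl <;>
      simp only [Equiv.Perm.mul_apply, Equiv.swap_apply_left, Equiv.swap_apply_right] <;> linarith

theorem weight_swap_of_ne {i : ℕ} (hi : 3 ≤ i) (hκμ : (μ : ℕ) = κ + 1)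
    {u u' v v' : Equiv.Perm (Fin n)} (hu : SwapRel κ μ u u') (hv : SwapRel κ μ v v')
    {x y : Fin n} (hx : letterClass i x = 1) (hy : letterClass i y = 2) {j : Fin n}
    (h1 : j ≠ κ) (h2 : j ≠ μ) : weight i u' v' j = weight i u v j := by
  obtain ⟨e1, e2⟩ := decide_mem_setB_swap_of_ne hi hκμ hu hv h1 h2
  rw [weight, weight, e1, e2, statA_swap hi hκμ hu hv hx hy h2, hu.apply_eq h1 h2,
    hv.apply_eq h1 h2]

theorem statA_succ (hκμ : (μ : ℕ) = κ + 1) (i : ℕ) (u v : Equiv.Perm (Fin n)) :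
    statA i u v μ = statA i u v κ
      + (((decide (u κ ∈ setB i u v)).toNat : ℤ) - ((decide (v κ ∈ setB i u v)).toNat : ℤ)) := by
  have : Finset.univ.filter (· < μ) = insert κ (Finset.univ.filter (· < κ)) := by
    ext r
    simp only [Finset.mem_filter, Finset.mem_univ, true_and, Finset.mem_insert, Fin.lt_def,
      Fin.ext_iff]
    omega
  rw [statA_eq_sum, statA_eq_sum, this, Finset.sum_insert (by simp), add_comm]

/-- The product of all weights is a local contribution of the window `{κ, μ}` times a factor
which does not change when the entries of `u` or of `v` in the window are exchanged. -/
theorem prod_weight_swap {i : ℕ} (hi : 3 ≤ i) (hκμ : (μ : ℕ) = κ + 1)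
    {u u' v v' : Equiv.Perm (Fin n)} (hu : SwapRel κ μ u u') (hv : SwapRel κ μ v v')
    {x y : Fin n} (hx : letterClass i x = 1) (hy : letterClass i y = 2) :
    ∏ j, weight i u' v' j = (∏ j ∈ (Finset.univ.erase κ).erase μ, weight i u v j)
      * windowWeight (LaurentPolynomial.T 1) (LaurentPolynomial.T (statA i u v κ - 1))
          (letterClass i (u' κ)) (letterClass i (u' μ)) (letterClass i (v' κ))
          (letterClass i (v' μ)) (decide (x ∈ setB i u v)) (decide (y ∈ setB i u v)) := by
  have hne : κ ≠ μ := fun h => by rw [h] at hκμ; omega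
  have hC : ∏ j ∈ (Finset.univ.erase κ).erase μ, weight i u' v' j
      = ∏ j ∈ (Finset.univ.erase κ).erase μ, weight i u v j := by
    refine Finset.prod_congr rfl fun j hj => ?_
    simp only [Finset.mem_erase] at hj
    exact weight_swap_of_ne hi hκμ hu hv hx hy hj.2.1 hj.1
  have hκ : weight i u' v' κ * weight i u' v' μ
      = windowWeight (LaurentPolynomial.T 1) (LaurentPolynomial.T (statA i u v κ - 1))
          (letterClass i (u' κ)) (letterClass i (u' μ)) (letterClass i (v' κ))
          (letterClass i (v' μ)) (decide (x ∈ setB i u v)) (decide (y ∈ setB i u v)) := by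
    have m := decide_mem_setB_eq_windowMem hi hκμ hu hv hx hy
    rw [weight, weight, windowWeight, statA_succ hκμ, statA_swap hi hκμ hu hv hx hy hne]
    generalize decide (x ∈ setB i u v) = g₁ at m ⊢
    generalize decide (y ∈ setB i u v) = g₂ at m ⊢
    rw [m, m, m, m]
    generalize windowMem _ _ _ _ _ _ _ = b₁
    generalize windowMem _ _ _ _ _ _ (letterClass i (v' κ)) = b₂
    have e1 : (LaurentPolynomial.T (statA i u v κ) : ℤ[T;T⁻¹])
        = LaurentPolynomial.T (statA i u v κ - 1) * LaurentPolynomial.T 1 := by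
      rw [← LaurentPolynomial.T_add, sub_add_cancel]
    -- The subtraction of natural numbers in the exponent is never truncated, as `b₂.toNat ≤ 1`.
    have e2 : (LaurentPolynomial.T (statA i u v κ + ((b₁.toNat : ℤ) - (b₂.toNat : ℤ))) : ℤ[T;T⁻¹])
        = LaurentPolynomial.T (statA i u v κ - 1)
          * LaurentPolynomial.T 1 ^ (1 + b₁.toNat - b₂.toNat) := by
      rw [LaurentPolynomial.T_pow, ← LaurentPolynomial.T_add]
      refine congrArg _ ?_
      cases b₁ <;> cases b₂ <;> simp <;> ring
    rw [e1, e2]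
  rw [← Finset.mul_prod_erase _ _ (Finset.mem_univ κ),
    ← Finset.mul_prod_erase _ _ (Finset.mem_erase.mpr ⟨hne.symm, Finset.mem_univ μ⟩), ← mul_assoc,
    hκ, hC, mul_comm]

end Locality

/-! ### Recursion, initial values and vanishing of the product of weights. -/

section Recursion

variable {n i : ℕ}

theorem perm_inv_apply_self (w : Equiv.Perm (Fin n)) (c : Fin n) : w⁻¹ (w c) = c :=
  w.symm_apply_apply c

theorem perm_apply_inv_self (w : Equiv.Perm (Fin n)) (c : Fin n) : w (w⁻¹ c) = c :=
  w.apply_symm_apply c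

/-- The set of the adjacent transpositions other than `s_{i-2}`, `s_{i-1}` and `s_i`. -/
def gensAway (n i : ℕ) : Set (Equiv.Perm (Fin n)) :=
  {s | ∃ (k : ℕ) (h1 : 1 ≤ k) (h2 : k < n), (k < i - 2 ∨ i < k) ∧ s = adj n k h1 h2}

theorem adj_injective {k k' : ℕ} (h1 : 1 ≤ k) (h2 : k < n) (h1' : 1 ≤ k') (h2' : k' < n)
    (h : adj n k h1 h2 = adj n k' h1' h2') : k = k' := by
  have h3 := congrArg (fun f : Equiv.Perm (Fin n) => ((f ⟨k, h2⟩ : Fin n) : ℕ)) h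
  have h4 := congrArg (fun f : Equiv.Perm (Fin n) => ((f ⟨k - 1, by omega⟩ : Fin n) : ℕ)) h
  simp only [adj, Equiv.swap_apply_def, Fin.ext_iff] at h3 h4
  split_ifs at h3 h4 <;> (try simp only at *) <;> omega

theorem gens_diff_eq_gensAway (h1 : 1 ≤ i - 2) (h2 : i - 2 < n) (h1' : 1 ≤ i - 1) (h2' : i - 1 < n)
    (h1'' : 1 ≤ i) (h2'' : i < n) :
    gens n \ {adj n (i - 2) h1 h2, adj n (i - 1) h1' h2', adj n i h1'' h2''}
      = gensAway n i := by
  ext s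
  simp only [Set.mem_sdiff, Set.mem_insert_iff, Set.mem_singleton_iff, not_or]
  constructor
  · rintro ⟨⟨k, k1, k2, rfl⟩, h3, h4, h5⟩
    refine ⟨k, k1, k2, ?_, rfl⟩
    by_contra hk
    have : k = i - 2 ∨ k = i - 1 ∨ k = i := by omega
    rcases this with rfl | rfl | rfl
    · exact h3 rfl
    · exact h4 rfl
    · exact h5 rfl
  · rintro ⟨k, k1, k2, hk, rfl⟩
    refine ⟨⟨k, k1, k2, rfl⟩, fun h => ?_, fun h => ?_, fun h => ?_⟩ <;>
      · have := adj_injective _ _ _ _ h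
        omega

theorem gensAway_subset : gensAway n i ⊆ gens n := by
  rintro s ⟨k, h1, h2, -, rfl⟩
  exact ⟨k, h1, h2, rfl⟩

/-- The letters of class `0`, and those of class `3`, appear in increasing order. -/
theorem inv_lt_inv_of_mem_minReps (hi : 3 ≤ i) {w : Equiv.Perm (Fin n)}
    (hw : w ∈ minReps (gens n) (gensAway n i)) {c d : Fin n} (hcd : c < d)
    (h : letterClass i c = letterClass i d)
    (h03 : letterClass i c = 0 ∨ letterClass i c = 3) : w⁻¹ c < w⁻¹ d := by
  have hadj : ∀ (k : ℕ) (h1 : 1 ≤ k) (h2 : k < n), (k < i - 2 ∨ i < k) →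
      w⁻¹ ⟨k - 1, by omega⟩ < w⁻¹ ⟨k, h2⟩ := fun k h1 h2 hk =>
    (length_lt_adj_mul_iff h1 h2 w).mp (hw _ ⟨k, h1, h2, hk, rfl⟩)
  have hrange : ((d : ℕ) + 1 ≤ i - 2) ∨ i ≤ (c : ℕ) := by
    rcases h03 with h0 | h0
    · rw [h, letterClass_eq_zero_iff] at h0
      exact Or.inl h0
    · rw [letterClass_eq_three_iff hi] at h0
      exact Or.inr h0
  have key : ∀ (e : ℕ) (he : (c : ℕ) + 1 + e ≤ d), w⁻¹ c < w⁻¹ ⟨(c : ℕ) + 1 + e, by omega⟩ := by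
    intro e
    induction e with
    | zero => exact fun he => hadj ((c : ℕ) + 1) (by omega) (by omega) (by omega)
    | succ e ih =>
      exact fun he => (ih (by omega)).trans
        (hadj ((c : ℕ) + 1 + (e + 1)) (by omega) (by omega) (by omega))
  have hcd' := Fin.lt_def.mp hcd
  have := key ((d : ℕ) - (c + 1)) (by omega)
  have e : (⟨(c : ℕ) + 1 + (d - (c + 1)), by omega⟩ : Fin n) = d := Fin.ext (by simp only; omega)
  rwa [e] at this

variable {κ μ : Fin n}

/-- Letters of equal class appear in increasing order in `w`, so a descent in letters is a strict
descent in classes. -/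
theorem letterClass_lt_of_apply_lt (hi : 3 ≤ i) {w : Equiv.Perm (Fin n)}
    (hw : w ∈ minReps (gens n) (gensAway n i)) {a b : Fin n} (hab : a < b) (h : w b < w a) :
    letterClass i (w b) < letterClass i (w a) := by
  refine lt_of_le_of_ne (letterClass_mono h.le) fun e => ?_
  have := inv_lt_inv_of_mem_minReps hi hw h e (letterClass_eq_zero_or_three hi w hab.ne' e)
  simp only [perm_inv_apply_self] at this
  order

/-- Exchanging two entries of equal class breaks their increasing order. Conversely, a condition
imposed by `J` compares letters `j`, `j + 1` of the same class, and `s` could reverse it only if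
these were the two entries exchanged. -/
theorem mul_adj_mem_minReps_iff (hi : 3 ≤ i) {u : Equiv.Perm (Fin n)}
    (hu : u ∈ minReps (gens n) (gensAway n i)) {k : ℕ} (h1 : 1 ≤ k) (h2 : k < n)
    (h : u ⟨k - 1, by omega⟩ < u ⟨k, h2⟩) :
    u * adj n k h1 h2 ∈ minReps (gens n) (gensAway n i)
      ↔ letterClass i (u ⟨k - 1, by omega⟩) ≠ letterClass i (u ⟨k, h2⟩) := by
  have hinv : (u * adj n k h1 h2)⁻¹ = adj n k h1 h2 * u⁻¹ := by
    rw [mul_inv_rev, inv_eq_of_mul_eq_one_left (adj_mul_self h1 h2)]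
  have hκμ : (⟨k - 1, by omega⟩ : Fin n) < ⟨k, h2⟩ := Fin.lt_def.mpr (by simp only; omega)
  constructor
  · intro hus e
    have := inv_lt_inv_of_mem_minReps hi hus h e (letterClass_eq_zero_or_three hi u hκμ.ne e)
    rw [hinv] at this
    simp only [Equiv.Perm.mul_apply, perm_inv_apply_self, adj, Equiv.swap_apply_left,
      Equiv.swap_apply_right] at this
    order
  · rintro hne _ ⟨j, j1, j2, hj, rfl⟩
    have hlt := hu _ ⟨j, j1, j2, hj, rfl⟩
    rw [length_lt_adj_mul_iff] at hlt ⊢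
    rw [hinv, Equiv.Perm.mul_apply, Equiv.Perm.mul_apply]
    apply adj_lt h1 h2 hlt
    rintro ⟨ha, hb⟩
    have ha' : u⁻¹ ⟨j - 1, by omega⟩ = ⟨k - 1, by omega⟩ := Fin.ext ha
    have hb' : u⁻¹ ⟨j, j2⟩ = ⟨k, h2⟩ := Fin.ext hb
    rw [Equiv.Perm.inv_eq_iff_eq] at ha' hb'
    rw [← ha', ← hb'] at hne
    apply hne
    unfold letterClass
    simp only
    split_ifs <;> first | rfl | (exfalso; omega)

theorem mem_rightDescents_adj_iff {k : ℕ} (h1 : 1 ≤ k) (h2 : k < n) (w : Equiv.Perm (Fin n)) :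
    adj n k h1 h2 ∈ rightDescents (gens n) w ↔ w ⟨k, h2⟩ < w ⟨k - 1, by omega⟩ := by
  rw [← length_mul_adj_lt_iff h1 h2]
  exact ⟨fun h => h.2, fun h => ⟨⟨k, h1, h2, rfl⟩, h⟩⟩

theorem apply_lt_of_notMem_rightDescents {k : ℕ} (h1 : 1 ≤ k) (h2 : k < n)
    {w : Equiv.Perm (Fin n)} (h : adj n k h1 h2 ∉ rightDescents (gens n) w) :
    w ⟨k - 1, by omega⟩ < w ⟨k, h2⟩ := by
  rw [mem_rightDescents_adj_iff] at h
  refine lt_of_le_of_ne (not_lt.mp h) fun e => ?_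
  have := congrArg Fin.val (w.injective e)
  simp only at this
  omega

/-- The constraints on a window which come from `i - 1` appearing before `i` in `v`. -/
theorem window_constraints (hi : 3 ≤ i) (hκμ : (μ : ℕ) = κ + 1) {u v : Equiv.Perm (Fin n)}
    {x y : Fin n} (hx : letterClass i x = 1) (hy : letterClass i y = 2) (hxy : v⁻¹ x < v⁻¹ y)
    (hv : letterClass i (v μ) < letterClass i (v κ)) :
    ¬ (letterClass i (v κ) = 2 ∧ letterClass i (v μ) = 1)
    ∧ (letterClass i (v κ) = 2 ∨ letterClass i (v μ) = 2 →
        letterClass i (u κ) = 1 ∨ letterClass i (u μ) = 1 → decide (x ∈ setB i u v) = true)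
    ∧ (letterClass i (v κ) = 1 ∨ letterClass i (v μ) = 1 →
        letterClass i (u κ) = 2 ∨ letterClass i (u μ) = 2 → decide (y ∈ setB i u v) = false)
    ∧ (letterClass i (u κ) = 1 ∨ letterClass i (u μ) = 1 →
        letterClass i (u κ) = 2 ∨ letterClass i (u μ) = 2 →
        decide (y ∈ setB i u v) = true → decide (x ∈ setB i u v) = true) := by
  have e1 : ∀ (w : Equiv.Perm (Fin n)) (j : Fin n), letterClass i (w j) = 1 ↔ w⁻¹ x = j := by
    intro w j
    rw [← hx, letterClass_eq_iff hi (Or.inl hx), Equiv.Perm.inv_eq_iff_eq, eq_comm]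
  have e2 : ∀ (w : Equiv.Perm (Fin n)) (j : Fin n), letterClass i (w j) = 2 ↔ w⁻¹ y = j := by
    intro w j
    rw [← hy, letterClass_eq_iff hi (Or.inr hy), Equiv.Perm.inv_eq_iff_eq, eq_comm]
  have hne : ¬ (letterClass i (v κ) = 1 ∧ letterClass i (v μ) = 2) := by
    rintro ⟨h1, h2⟩
    rw [h1, h2] at hv
    exact absurd hv (by decide)
  have hu : u⁻¹ x ≠ u⁻¹ y := fun h => by
    rw [u⁻¹.injective h, hy] at hx
    exact absurd hx (by decide)
  rw [decide_eq_true_iff, decide_eq_true_iff, decide_eq_false_iff_not,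
    mem_setB_iff_of_special hi (Or.inl hx), mem_setB_iff_of_special hi (Or.inr hy)]
  -- What remains is arithmetic of positions. If `y` is in the window of `v`, then `x` precedes it
  -- and, as `(1, 2)` is excluded by `hv`, lies left of the window; symmetrically, if `x` is there,
  -- `y` lies right of it. If the window of `u` holds both and `y ∈ B`, then `v⁻¹ x < v⁻¹ y ≤ μ`
  -- puts `v⁻¹ x` at or before `κ`, so `x ∈ B`.
  simp only [e1, e2, Fin.ext_iff, Fin.le_def, Fin.lt_def, ne_eq] at *
  omega

variable {x y : Fin n}

/-- The recursion of the products of weights along a right descent of `v`. -/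
theorem prod_weight_recursion (hi : 3 ≤ i) (hx : letterClass i x = 1) (hy : letterClass i y = 2)
    {u v s : Equiv.Perm (Fin n)} (hu : u ∈ minReps (gens n) (gensAway n i))
    (hv : v ∈ minReps (gens n) (gensAway n i)) (hxy : v⁻¹ x < v⁻¹ y)
    (hs : s ∈ rightDescents (gens n) v) :
    (s ∈ rightDescents (gens n) u →
      ∏ j, weight i u v j = ∏ j, weight i (u * s) (v * s) j)
    ∧ (s ∉ rightDescents (gens n) u → u * s ∈ minReps (gens n) (gensAway n i) →
      ∏ j, weight i u v j = LaurentPolynomial.T 1 * ∏ j, weight i (u * s) (v * s) j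
        + (1 - LaurentPolynomial.T 1) * ∏ j, weight i u (v * s) j)
    ∧ (s ∉ rightDescents (gens n) u → u * s ∉ minReps (gens n) (gensAway n i) →
      ∏ j, weight i u v j = ∏ j, weight i u (v * s) j) := by
  obtain ⟨k, h1, h2, rfl⟩ := hs.1
  have hκμ : ((⟨k, h2⟩ : Fin n) : ℕ) = ((⟨k - 1, by omega⟩ : Fin n) : ℕ) + 1 := by
    simp only
    omega
  have hlt : (⟨k - 1, by omega⟩ : Fin n) < ⟨k, h2⟩ := Fin.lt_def.mpr (by simp only; omega)
  have hvc := letterClass_lt_of_apply_lt hi hv hlt ((mem_rightDescents_adj_iff h1 h2 v).mp hs)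
  obtain ⟨c0, c1, c2, c3⟩ := window_constraints (u := u) hi hκμ hx hy hxy hvc
  have r1 : ∀ w : Equiv.Perm (Fin n), SwapRel (⟨k - 1, by omega⟩ : Fin n) ⟨k, h2⟩ w w :=
    SwapRel.refl
  have r2 : ∀ w : Equiv.Perm (Fin n),
      SwapRel (⟨k - 1, by omega⟩ : Fin n) ⟨k, h2⟩ w (w * adj n k h1 h2) := fun w => Or.inr rfl
  rw [prod_weight_swap hi hκμ (r1 u) (r1 v) hx hy, prod_weight_swap hi hκμ (r2 u) (r2 v) hx hy,
    prod_weight_swap hi hκμ (r1 u) (r2 v) hx hy]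
  have sκ : ∀ w : Equiv.Perm (Fin n), (w * adj n k h1 h2) ⟨k - 1, by omega⟩ = w ⟨k, h2⟩ :=
    fun w => by simp [adj]
  have sμ : ∀ w : Equiv.Perm (Fin n), (w * adj n k h1 h2) ⟨k, h2⟩ = w ⟨k - 1, by omega⟩ :=
    fun w => by simp [adj]
  rw [sκ, sκ, sμ, sμ]
  refine ⟨fun h => ?_, fun h hus => ?_, fun h hus => ?_⟩
  · rw [mem_rightDescents_adj_iff] at h
    rw [windowWeight_descent _ _ _ _ (letterClass_lt_of_apply_lt hi hu hlt h) hvc c0 c1 c2 c3]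
  · have h' := apply_lt_of_notMem_rightDescents h1 h2 h
    rw [mul_adj_mem_minReps_iff hi hu h1 h2 h'] at hus
    rw [windowWeight_ascent _ _ _ _ (lt_of_le_of_ne (letterClass_mono h'.le) hus) hvc c0 c1 c2 c3]
    ring
  · have h' := apply_lt_of_notMem_rightDescents h1 h2 h
    rw [mul_adj_mem_minReps_iff hi hu h1 h2 h', not_not] at hus
    have h03 := letterClass_eq_zero_or_three hi u hlt.ne hus
    rw [← hus, windowWeight_level _ _ _ _ h03 hvc c0]

theorem statA_self (v : Equiv.Perm (Fin n)) (j : Fin n) : statA i v v j = 0 := sub_self _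

theorem prod_weight_self (v : Equiv.Perm (Fin n)) : ∏ j, weight i v v j = 1 := by
  refine Finset.prod_eq_one fun j _ => ?_
  rw [weight, localWeight, statA_self]
  simp

/-- Let `j` be the first position moved by `u`. Nothing differs before it, so `a_j = 0`; moreover `j
∈ B` and `u j ∉ B`, so the weight of `j` contains the factor `1 - q^0`. -/
theorem prod_weight_one_eq_zero (hi : 3 ≤ i) {u : Equiv.Perm (Fin n)}
    (hu : u ∈ minReps (gens n) (gensAway n i)) (hne : u ≠ 1) : ∏ j, weight i u 1 j = 0 := by
  have hex : (Finset.univ.filter fun j => u j ≠ j).Nonempty := by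
    by_contra h
    rw [Finset.not_nonempty_iff_eq_empty, Finset.filter_eq_empty_iff] at h
    exact hne (Equiv.ext fun j => by simpa using h (Finset.mem_univ j))
  obtain ⟨j, hj, hmin⟩ := Finset.exists_min_image _ id hex
  have hj' : u j ≠ j := by simpa using hj
  have hfix : ∀ r, r < j → u r = r := by
    intro r hr
    by_contra h
    exact absurd (hmin r (by simpa using h)) (not_le.mpr hr)
  have hgt : j < u j := by
    refine lt_of_le_of_ne (not_lt.mp fun h => ?_) (Ne.symm hj')
    exact hj' (u.injective (hfix _ h))
  have hinv : j ≤ u⁻¹ j := by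
    by_contra h
    have h2 := hfix _ (not_le.mp h)
    rw [perm_apply_inv_self] at h2
    exact h h2.le
  -- Equality of classes would force the larger letter `u j` to come after `j` in `u`, while it
  -- stands at position `j ≤ u⁻¹ j`.
  have hcl : letterClass i j < letterClass i (u j) := by
    refine lt_of_le_of_ne (letterClass_mono hgt.le) fun e => ?_
    by_cases h12 : letterClass i (u j) = 1 ∨ letterClass i (u j) = 2
    · exact hj' ((letterClass_eq_iff hi h12).mp e).symm
    · have h03 : letterClass i j = 0 ∨ letterClass i j = 3 := by
        rw [← e] at h12
        revert h12
        generalize letterClass i j = c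
        revert c
        decide
      have := inv_lt_inv_of_mem_minReps hi hu hgt e h03
      rw [perm_inv_apply_self] at this
      order
  have hstat : statA i u 1 j = 0 := by
    rw [statA_eq_sum]
    refine Finset.sum_eq_zero fun r hr => ?_
    rw [hfix r (Finset.mem_filter.mp hr).2, Equiv.Perm.one_apply, sub_self]
  have hmem : j ∈ setB i u 1 := by
    rw [mem_setB_iff hi, inv_one, Equiv.Perm.one_apply]
    have : letterClass i j = 0 ∨ letterClass i j = 1 ∨ letterClass i j = 2 := by
      revert hcl
      generalize letterClass i j = c
      generalize letterClass i (u j) = d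
      revert c d
      decide
    tauto
  have hnot : u j ∉ setB i u 1 := by
    rw [mem_setB_iff hi, inv_one, Equiv.Perm.one_apply, perm_inv_apply_self]
    rintro (h | h)
    · rw [h] at hcl
      exact absurd hcl (Fin.not_lt_zero _)
    · exact absurd hgt (not_lt.mpr h.2)
  refine Finset.prod_eq_zero (Finset.mem_univ j) ?_
  rw [weight, localWeight, hstat]
  simp [hmem, hnot]

theorem eq_one_of_length_eq_zero {v : Equiv.Perm (Fin n)} (h : length (gens n) v = 0) : v = 1 := by
  rw [length_eq_card_inv, Finset.card_eq_zero] at h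
  have hmono : StrictMono v := by
    intro a b hab
    by_contra hlt
    have hmem : (a, b) ∈ inversions v := (mem_inversions v a b).mpr
      ⟨hab, lt_of_le_of_ne (not_lt.mp hlt) fun h => hab.ne' (v.injective h)⟩
    simp [h] at hmem
  have h := Subsingleton.elim (hmono.orderIsoOfSurjective v v.surjective) (OrderIso.refl _)
  exact Equiv.ext fun a => congrArg (fun f : Fin n ≃o Fin n => f a) h

/-- Only an exchange of `x` and `y` at adjacent positions could reverse their order, but there `v`
has an ascent. This keeps the hypothesis on `v` available in the induction. -/
theorem inv_lt_inv_mul_of_rightDescent (hi : 3 ≤ i) (hx : letterClass i x = 1)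
    (hy : letterClass i y = 2) {v s : Equiv.Perm (Fin n)} (hxy : v⁻¹ x < v⁻¹ y)
    (hs : s ∈ rightDescents (gens n) v) : (v * s)⁻¹ x < (v * s)⁻¹ y := by
  obtain ⟨k, h1, h2, rfl⟩ := hs.1
  rw [mem_rightDescents_adj_iff] at hs
  rw [mul_inv_rev, inv_eq_of_mul_eq_one_left (adj_mul_self h1 h2), Equiv.Perm.mul_apply,
    Equiv.Perm.mul_apply]
  apply adj_lt h1 h2 hxy
  rintro ⟨ha, hb⟩
  have ha' : v⁻¹ x = ⟨k - 1, by omega⟩ := Fin.ext ha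
  have hb' : v⁻¹ y = ⟨k, h2⟩ := Fin.ext hb
  rw [Equiv.Perm.inv_eq_iff_eq] at ha' hb'
  rw [← ha', ← hb', Fin.lt_def] at hs
  rw [letterClass_eq_one_iff hi] at hx
  rw [letterClass_eq_two_iff hi] at hy
  omega

theorem length_mul_add_one_of_rightDescent {v s : Equiv.Perm (Fin n)}
    (hs : s ∈ rightDescents (gens n) v) : length (gens n) (v * s) + 1 = length (gens n) v := by
  obtain ⟨k, h1, h2, rfl⟩ := hs.1
  rw [mem_rightDescents_adj_iff] at hs
  rw [length_eq_card_inv, length_eq_card_inv, card_inv_mul_adj' h1 h2 v hs]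

theorem length_mul_of_notMem_rightDescents {u s : Equiv.Perm (Fin n)} (hs : s ∈ gens n)
    (hu : s ∉ rightDescents (gens n) u) :
    length (gens n) (u * s) = length (gens n) u + 1 := by
  obtain ⟨k, h1, h2, rfl⟩ := hs
  rw [length_eq_card_inv, length_eq_card_inv,
    card_inv_mul_adj h1 h2 u (apply_lt_of_notMem_rightDescents h1 h2 hu)]

/-- Every term on the right of the recursion vanishes by induction: `u ≤ vs` would give `u ≤ v` as
`vs < v`, and `us ≤ vs` would give it by lifting. -/
theorem prod_weight_eq_zero_of_not_bruhatLE (hi : 3 ≤ i) (hx : letterClass i x = 1)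
    (hy : letterClass i y = 2) (m : ℕ) : ∀ v ∈ minReps (gens n) (gensAway n i),
      length (gens n) v = m → v⁻¹ x < v⁻¹ y → ∀ u ∈ minReps (gens n) (gensAway n i),
      ¬ BruhatLE (gens n) u v → ∏ j, weight i u v j = 0 := by
  induction m with
  | zero =>
    intro v hv hm hxy u hu huv
    obtain rfl := eq_one_of_length_eq_zero hm
    refine prod_weight_one_eq_zero hi hu ?_
    rintro rfl
    exact huv Relation.ReflTransGen.refl
  | succ m ih =>
    intro v hv hm hxy u hu huv
    obtain ⟨s, hs⟩ := exists_rightDescent (fun _ => gens_mul_self) (v := v) (by omega)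
    have hvs := mul_mem_minReps gensAway_subset hv hs
    have hxy' := inv_lt_inv_mul_of_rightDescent hi hx hy hxy hs
    have hl := length_mul_add_one_of_rightDescent hs
    have hle := bruhatLE_of_rightDescent (fun _ => gens_mul_self) hs
    obtain ⟨e1, e2, e3⟩ := prod_weight_recursion hi hx hy hu hv hxy hs
    have z1 : u * s ∈ minReps (gens n) (gensAway n i) →
        ∏ j, weight i (u * s) (v * s) j = 0 := fun hus =>
      ih _ hvs (by omega) hxy' _ hus fun h => huv (bruhatLE_of_mul_le_mul hs h)
    have z2 : ∏ j, weight i u (v * s) j = 0 :=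
      ih _ hvs (by omega) hxy' _ hu fun h => huv (h.trans hle)
    by_cases hsu : s ∈ rightDescents (gens n) u
    · rw [e1 hsu, z1 (mul_mem_minReps gensAway_subset hu hsu)]
    · by_cases hus : u * s ∈ minReps (gens n) (gensAway n i)
      · rw [e2 hsu hus, z1 hus, z2]
        simp
      · rw [e3 hsu hus, z2]

/-- If a function `g` of pairs has the values and the recursion which define the parabolic
`R`-polynomials, then it describes them. -/
theorem toLaurent_parabolicR_eq (hi : 3 ≤ i) (hx : letterClass i x = 1) (hy : letterClass i y = 2)
    (z : ℤ[X]) (g : Equiv.Perm (Fin n) → Equiv.Perm (Fin n) → ℤ[T;T⁻¹])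
    (hz : ∀ v ∈ minReps (gens n) (gensAway n i), v⁻¹ x < v⁻¹ y →
      ∀ u ∈ minReps (gens n) (gensAway n i), ¬ BruhatLE (gens n) u v → g u v = 0)
    (h1 : ∀ v, g v v = 1)
    (hrec : ∀ v ∈ minReps (gens n) (gensAway n i), v⁻¹ x < v⁻¹ y →
      ∀ u ∈ minReps (gens n) (gensAway n i), ∀ s ∈ rightDescents (gens n) v,
      (s ∈ rightDescents (gens n) u → g u v = g (u * s) (v * s))
      ∧ (s ∉ rightDescents (gens n) u → u * s ∈ minReps (gens n) (gensAway n i) →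
        g u v = LaurentPolynomial.T 1 * g (u * s) (v * s)
          + (LaurentPolynomial.T 1 - 1) * g u (v * s))
      ∧ (s ∉ rightDescents (gens n) u → u * s ∉ minReps (gens n) (gensAway n i) →
        g u v = (LaurentPolynomial.T 1 - 1 - Polynomial.toLaurent z) * g u (v * s)))
    (m : ℕ) : ∀ v ∈ minReps (gens n) (gensAway n i), length (gens n) v = m → v⁻¹ x < v⁻¹ y →
      ∀ u ∈ minReps (gens n) (gensAway n i),
      Polynomial.toLaurent (parabolicR (gens n) (gensAway n i) z u v) = g u v := by
  induction m with
  | zero =>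
    intro v hv hm hxy u hu
    by_cases huv : BruhatLE (gens n) u v
    · have hne : u = v := by
        by_contra hne
        have := length_lt_of_bruhat_ne huv hne
        omega
      subst hne
      rw [h1, parabolicR]
      simp [huv]
    · rw [hz v hv hxy u hu huv, parabolicR]
      simp [huv]
  | succ m ih =>
    intro v hv hm hxy u hu
    by_cases huv : BruhatLE (gens n) u v
    · by_cases hne : u = v
      · subst hne
        rw [h1, parabolicR]
        simp [huv]
      · obtain ⟨s, hs, he⟩ := parabolicR_eq (gens n) (gensAway n i) z u v huv hne
          (exists_rightDescent (fun _ => gens_mul_self) (by omega))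
        have hvs := mul_mem_minReps gensAway_subset hv hs
        have hxy' := inv_lt_inv_mul_of_rightDescent hi hx hy hxy hs
        have hl := length_mul_add_one_of_rightDescent hs
        have ih' := ih _ hvs (by omega) hxy'
        obtain ⟨e1, e2, e3⟩ := hrec v hv hxy u hu s hs
        rw [he, recursionStep]
        split_ifs with hsu hus
        · rw [e1 hsu, ih' _ (mul_mem_minReps gensAway_subset hu hsu)]
        · rw [e2 hsu hus, map_add, map_mul, map_mul, ih' _ hus, ih' _ hu, map_sub, map_one,
            Polynomial.toLaurent_X]
        · rw [e3 hsu hus, map_mul, ih' _ hu, map_sub, map_sub, map_one, Polynomial.toLaurent_X]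
    · rw [hz v hv hxy u hu huv, parabolicR]
      simp [huv]

theorem prod_weight_eq (hi : 3 ≤ i) (hx : letterClass i x = 1) (hy : letterClass i y = 2)
    (u v : Equiv.Perm (Fin n)) :
    ∏ j, weight i u v j = factor i u v x * factor i u v y
      * ∏ j ∈ setD i u v, (1 - LaurentPolynomial.T (statA i u v j)) := by
  have hxy : x ≠ y := fun h => by
    rw [h, hy] at hx
    exact absurd hx (by decide)
  simp only [weight, localWeight]
  rw [Finset.prod_mul_distrib]
  congr 1
  -- Indexing positions by the letters of `v` leaves only the letters `x` and `y` with a nontrivial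
  -- first factor.
  · rw [← Equiv.prod_comp v⁻¹]
    simp only [perm_apply_inv_self]
    rw [← Finset.prod_filter]
    have : (Finset.univ.filter fun c : Fin n => letterClass i c = 1 ∨ letterClass i c = 2)
        = {x, y} := by
      ext c
      simp only [Finset.mem_filter, Finset.mem_univ, true_and, Finset.mem_insert,
        Finset.mem_singleton]
      rw [← letterClass_eq_iff hi (Or.inl hx), ← letterClass_eq_iff hi (Or.inr hy), hx, hy]
    rw [this, Finset.prod_pair hxy]
    have hf : ∀ t : Fin n, letterClass i t = 1 ∨ letterClass i t = 2 →
        (1 - LaurentPolynomial.T 1 + (if letterClass i (u (v⁻¹ t)) = letterClass i t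
          then LaurentPolynomial.T 1 * LaurentPolynomial.T (statA i u v (v⁻¹ t)) else 0)
          : ℤ[T;T⁻¹]) = factor i u v t := by
      intro t ht
      have : u⁻¹ t = v⁻¹ t ↔ letterClass i (u (v⁻¹ t)) = letterClass i t := by
        rw [letterClass_eq_iff hi ht, Equiv.Perm.inv_eq_iff_eq, eq_comm]
      simp only [factor, this, LaurentPolynomial.T_add]
    rw [hf x (Or.inl hx), hf y (Or.inr hy)]
  · rw [setD, Finset.prod_filter]
    refine Finset.prod_congr rfl fun j _ => ?_
    simp

end Recursion

/-! ### The two normalizations, for `x = q` and `x = -1`. -/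

section Formula

variable {n i : ℕ} {x y : Fin n}

/-- With `x = q` the last coefficient of the recursion is `-1`, which the sign absorbs. The exponent
`ℓ(v) + ℓ(u)` has the parity of `ℓ(v) - ℓ(u)` and avoids truncated subtraction. -/
theorem toLaurent_parabolicR_X (hi : 3 ≤ i) (hx : letterClass i x = 1) (hy : letterClass i y = 2)
    {u v : Equiv.Perm (Fin n)} (hu : u ∈ minReps (gens n) (gensAway n i))
    (hv : v ∈ minReps (gens n) (gensAway n i)) (hxy : v⁻¹ x < v⁻¹ y) :
    Polynomial.toLaurent (parabolicR (gens n) (gensAway n i) Polynomial.X u v)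
      = (-1) ^ (length (gens n) v + length (gens n) u) * ∏ j, weight i u v j := by
  refine toLaurent_parabolicR_eq hi hx hy Polynomial.X
    (fun u v => (-1) ^ (length (gens n) v + length (gens n) u) * ∏ j, weight i u v j)
    (fun v hv hxy u hu huv => ?_) (fun v => ?_) (fun v hv hxy u hu s hs => ?_) _ v hv rfl hxy u hu
  · simp only [prod_weight_eq_zero_of_not_bruhatLE hi hx hy _ v hv rfl hxy u hu huv, mul_zero]
  · simp [prod_weight_self, ← two_mul]
  · obtain ⟨e1, e2, e3⟩ := prod_weight_recursion hi hx hy hu hv hxy hs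
    have hl := length_mul_add_one_of_rightDescent hs
    simp only [← hl, Polynomial.toLaurent_X]
    refine ⟨fun h => ?_, fun h hus => ?_, fun h hus => ?_⟩
    · rw [e1 h, ← length_mul_add_one_of_rightDescent h]
      ring
    · rw [e2 h hus, length_mul_of_notMem_rightDescents hs.1 h]
      ring
    · rw [e3 h hus]
      ring

/-- With `x = -1` the last coefficient is `q`, absorbed by the power of `q`; in the middle case `q -
1 = q (1 - 1/q)` matches the inverted recursion. -/
theorem toLaurent_parabolicR_neg_one (hi : 3 ≤ i) (hx : letterClass i x = 1)
    (hy : letterClass i y = 2) {u v : Equiv.Perm (Fin n)}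
    (hu : u ∈ minReps (gens n) (gensAway n i)) (hv : v ∈ minReps (gens n) (gensAway n i))
    (hxy : v⁻¹ x < v⁻¹ y) :
    Polynomial.toLaurent (parabolicR (gens n) (gensAway n i) (-1) u v)
      = LaurentPolynomial.T ((length (gens n) v : ℤ) - (length (gens n) u : ℤ))
        * LaurentPolynomial.invert (∏ j, weight i u v j) := by
  have hT : (LaurentPolynomial.T 1 * LaurentPolynomial.T (-1) : ℤ[T;T⁻¹]) = 1 := by
    rw [← LaurentPolynomial.T_add, add_neg_cancel, LaurentPolynomial.T_zero]
  refine toLaurent_parabolicR_eq hi hx hy (-1)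
    (fun u v => LaurentPolynomial.T ((length (gens n) v : ℤ) - (length (gens n) u : ℤ))
        * LaurentPolynomial.invert (∏ j, weight i u v j))
    (fun v hv hxy u hu huv => ?_) (fun v => ?_) (fun v hv hxy u hu s hs => ?_) _ v hv rfl hxy u hu
  · simp only [prod_weight_eq_zero_of_not_bruhatLE hi hx hy _ v hv rfl hxy u hu huv, map_zero,
      mul_zero]
  · simp only [prod_weight_self, sub_self, LaurentPolynomial.T_zero, map_one, mul_one]
  · obtain ⟨e1, e2, e3⟩ := prod_weight_recursion hi hx hy hu hv hxy hs
    have hl := length_mul_add_one_of_rightDescent hs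
    simp only [← hl, map_neg, map_one]
    refine ⟨fun h => ?_, fun h hus => ?_, fun h hus => ?_⟩
    · rw [e1 h, ← length_mul_add_one_of_rightDescent h]
      push_cast
      rw [add_sub_add_right_eq_sub]
    · have e : ((length (gens n) (v * s) + 1 : ℕ) : ℤ) - (length (gens n) u : ℤ)
          = ((length (gens n) (v * s) : ℤ) - (length (gens n) u : ℤ)) + 1 := by
        push_cast
        ring
      have e' : (length (gens n) (v * s) : ℤ) - ((length (gens n) u + 1 : ℕ) : ℤ)
          = ((length (gens n) (v * s) : ℤ) - (length (gens n) u : ℤ)) + (-1) := by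
        push_cast
        ring
      rw [e2 h hus, length_mul_of_notMem_rightDescents hs.1 h, e, e', LaurentPolynomial.T_add,
        LaurentPolynomial.T_add]
      simp only [map_add, map_mul, map_sub, map_one, LaurentPolynomial.invert_T]
      linear_combination (-LaurentPolynomial.T ((length (gens n) (v * s) : ℤ) - length (gens n) u)
        * LaurentPolynomial.invert (∏ j, weight i u (v * s) j)) * hT
    · have e : ((length (gens n) (v * s) + 1 : ℕ) : ℤ) - (length (gens n) u : ℤ)
          = ((length (gens n) (v * s) : ℤ) - (length (gens n) u : ℤ)) + 1 := by
        push_cast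
        ring
      rw [e3 h hus, e, LaurentPolynomial.T_add]
      ring

end Formula

end ParabolicKL

theorem theorem2p1 (n i : ℕ) (hi : 3 ≤ i) (hin : i < n) (J : Set (Equiv.Perm (Fin n)))
    (hJ : J = ParabolicKL.gens n \
      {ParabolicKL.adj n (i - 2) (by omega) (by omega),
        ParabolicKL.adj n (i - 1) (by omega) (by omega),
        ParabolicKL.adj n i (by omega) (by omega)})
    (v : Equiv.Perm (Fin n)) (hv : v ∈ ParabolicKL.minReps (ParabolicKL.gens n) J)
    (hiv : v⁻¹ (ParabolicKL.letter n (i - 1) (by omega) (by omega))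
      < v⁻¹ (ParabolicKL.letter n i (by omega) (by omega)))
    (u : Equiv.Perm (Fin n)) (hu : u ∈ ParabolicKL.minReps (ParabolicKL.gens n) J)
    (huv : ParabolicKL.BruhatLE (ParabolicKL.gens n) u v) :
    Polynomial.toLaurent (ParabolicKL.parabolicR (ParabolicKL.gens n) J Polynomial.X u v)
        = (-1) ^ (ParabolicKL.length (ParabolicKL.gens n) v
            - ParabolicKL.length (ParabolicKL.gens n) u)
          * ParabolicKL.factor i u v (ParabolicKL.letter n (i - 1) (by omega) (by omega))
          * ParabolicKL.factor i u v (ParabolicKL.letter n i (by omega) (by omega))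
          * ∏ j ∈ ParabolicKL.setD i u v,
              (1 - LaurentPolynomial.T (ParabolicKL.statA i u v j))
    ∧ Polynomial.toLaurent (ParabolicKL.parabolicR (ParabolicKL.gens n) J (-1) u v)
        = LaurentPolynomial.T ((ParabolicKL.length (ParabolicKL.gens n) v : ℤ)
            - (ParabolicKL.length (ParabolicKL.gens n) u : ℤ))
          * LaurentPolynomial.invert
              (ParabolicKL.factor i u v (ParabolicKL.letter n (i - 1) (by omega) (by omega))
                * ParabolicKL.factor i u v (ParabolicKL.letter n i (by omega) (by omega))
                * ∏ j ∈ ParabolicKL.setD i u v,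
                    (1 - LaurentPolynomial.T (ParabolicKL.statA i u v j))) := by

  rw [ParabolicKL.gens_diff_eq_gensAway] at hJ
  subst hJ
  have hx : ParabolicKL.letterClass i (ParabolicKL.letter n (i - 1) (by omega) (by omega)) = 1 := by
    rw [ParabolicKL.letterClass_eq_one_iff hi, ParabolicKL.letter]
    simp only
    omega
  have hy : ParabolicKL.letterClass i (ParabolicKL.letter n i (by omega) (by omega)) = 2 := by
    rw [ParabolicKL.letterClass_eq_two_iff hi, ParabolicKL.letter]
    simp only
    omega
  rw [ParabolicKL.toLaurent_parabolicR_X hi hx hy hu hv hiv,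
    ParabolicKL.toLaurent_parabolicR_neg_one hi hx hy hu hv hiv,
    ← ParabolicKL.prod_weight_eq hi hx hy]
  refine ⟨?_, rfl⟩
  -- Here `u ≤ v` is needed: it makes the natural subtraction in the exponent of `-1` exact.
  have hle : ParabolicKL.length (ParabolicKL.gens n) u
      ≤ ParabolicKL.length (ParabolicKL.gens n) v := by
    by_cases h : u = v
    · rw [h]
    · exact (ParabolicKL.length_lt_of_bruhat_ne huv h).le
  rw [mul_assoc, mul_assoc, ← mul_assoc (ParabolicKL.factor i u v _),
    ← ParabolicKL.prod_weight_eq hi hx hy]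
  congr 1
  obtain ⟨d, hd⟩ := Nat.exists_eq_add_of_le hle
  rw [hd, Nat.add_sub_cancel_left, add_right_comm, ← two_mul, pow_add, pow_mul]
  simp
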